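/- Let $(\mathcal X,\mathcal F)$ be a measurable space with a reference measure $\mu$, let $\pi(dx)=\pi(x)\,\mu(dx)$ be a probability measure such that $\{\pi(x)=0\}$ is $\mu$-null, and let $P$ be a Markov kernel on $\mathcal X$ with stationary distribution $\pi$ and with a jointly measurable density, $P(x,dy)=p(x,y)\,\mu(dy)$. Write $p^*(x,y)=\pi(y)p(y,x)/\pi(x)$ for the density of the time reversal $P^*$ of $P$. The two Metropolis--Hastings kernels of $P$ are $$M_1(P)(x,dy)=\min\{p(x,y),p^*(x,y)\}\,\mu(dy)+r_1(x)\,\delta_x(dy),\qquad M_2(P)(x,dy)=\max\{p(x,y),p^*(x,y)\}\,\mu(dy)-r_1(x)\,\delta_x(dy),$$ where $r_1(x)=1-\int\min\{p(x,y),p^*(x,y)\}\,\mu(dy)$. They act as bounded self-adjoint operators on $L^2_0(\pi)$, the space of complex functions in $L^2(\pi)$ with $\pi$-mean zero. For such an operator $M$ let $\lambda(M)$ and $\Lambda(M)$ be the infimum and the supremum of its spectrum on $L^2_0(\pi)$ (both are taken to be $0$ if $L^2_0(\pi)=\{0\}$). For $n\ge 1$ the kernels $M_i(P^n)$ are formed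 in the same way from the $n$-step kernel $P^n$. Put $$\mathcal C=\{n\ge 1:\ |\lambda(M_2(P^n))|<1,\ \Lambda(M_1(P^n))<1\},\qquad \mathcal C^c=\{1,2,\dots\}\setminus\mathcal C,$$ $$\beta^{MH}=\sup_{n\in\mathcal C}\max\bigl\{|\lambda(M_2(P^n))|^{1/n},\ \max(\Lambda(M_1(P^n)),0)^{1/n}\bigr\}\ \text{ if }\mathcal C\ne\emptyset,\qquad \beta^{MH}=1\ \text{ if }\mathcal C=\emptyset,\qquad \gamma^{MH}=1-\beta^{MH}.$$ Theorem. Let $(X_n)_{n\ge 0}$ be a Markov chain with kernel $P$ and $X_0\sim\pi$; for a complex random variable $Z$ write $\mathrm{Var}_\pi(Z)=\mathbb E|Z-\mathbb EZ|^2$. (1) If $f\in L^2(\pi)$ and $V_f=\mathrm{Var}_\pi(f)$, then for every $n$ $$\mathrm{Var}_\pi\Bigl(\sum_{i=1}^n f(X_i)\Bigr)\le nV_f\Bigl(|\mathcal C^c|+\frac{2}{\gamma^{MH}}\Bigr).$$ (2) If $f\in L^2(\pi)$, $|\mathcal C^c|<\infty$ and $\gamma^{MH}>0$, then the limit $\sigma_{as}^2=\lim_{n\to\infty}\frac1n\mathrm{Var}_\pi\bigl(\sum_{i=1}^n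 f(X_i)\bigr)$ exists and is finite, and for every $n$ $$\Bigl|\mathrm{Var}_\pi\Bigl(\sum_{i=1}^n f(X_i)\Bigr)-n\sigma_{as}^2\Bigr|\le 4V_f\Bigl(1+|\mathcal C^c|+\frac{4(\beta^{MH})^{|\mathcal C^c|+1}}{\gamma^{MH}}\Bigr)^2.$$ (3) If $f_1,\dots,f_n\in L^2(\pi)$, then $$\mathrm{Var}_\pi\Bigl(\sum_{i=1}^n f_i(X_i)\Bigr)\le\sum_{i=1}^n\mathrm{Var}_\pi(f_i(X_i))\Bigl(|\mathcal C^c|+\frac{2}{\gamma^{MH}}\Bigr).$$ In (1) and (3) the bracket is $+\infty$ if $|\mathcal C^c|=\infty$ or $\gamma^{MH}=0$, with $0\cdot\infty=0$. -/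

import Mathlib

open MeasureTheory ProbabilityTheory Filter Topology
open scoped NNReal ENNReal

noncomputable section

namespace MHGap

/-- A target probability law `π(dx) = π(x) μ(dx)` on the state space, given by its density with
respect to the reference measure `μ`; the set `{π = 0}` is `μ`-null. -/
structure Target {E : Type*} [MeasurableSpace E] (μ : Measure E) where
  dens : E → ℝ≥0
  measurable_dens : Measurable dens
  lintegral_dens : ∫⁻ x, dens x ∂μ = 1
  null_dens : μ {x | dens x = 0} = 0

namespace Target

variable {E : Type*} [MeasurableSpace E] {μ : Measure E} (T : Target μ)

/-- The probability measure `π`. -/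
def law : Measure E := μ.withDensity (fun x => (T.dens x : ℝ≥0∞))

instance isProbabilityMeasure_law : IsProbabilityMeasure T.law :=
  ⟨by simp [law, T.lintegral_dens]⟩

lemma ae_ne_zero : ∀ᵐ x ∂μ, T.dens x ≠ 0 := by
  rw [ae_iff]; simpa using T.null_dens

lemma law_ac : T.law ≪ μ := withDensity_absolutelyContinuous _ _

lemma ac_law : μ ≪ T.law :=
  withDensity_absolutelyContinuous' T.measurable_dens.coe_nnreal_ennreal.aemeasurable
    (T.ae_ne_zero.mono fun x hx => by simpa using hx)

/-- The reference measure is automatically s-finite. -/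
lemma sFinite {E : Type*} [MeasurableSpace E] {μ : Measure E} (T : Target μ) : SFinite μ := by
  have h := withDensity_inv_same (μ := μ) T.measurable_dens.coe_nnreal_ennreal
    (T.ae_ne_zero.mono fun x hx => by simpa using hx) (by simp)
  rw [← h]
  have : SFinite (μ.withDensity (fun x => (T.dens x : ℝ≥0∞))) :=
    inferInstanceAs (SFinite T.law)
  infer_instance

lemma lintegral_law {F : E → ℝ≥0∞} (hF : Measurable F) :
    ∫⁻ x, F x ∂T.law = ∫⁻ x, (T.dens x : ℝ≥0∞) * F x ∂μ := by
  rw [law, lintegral_withDensity_eq_lintegral_mul _ T.measurable_dens.coe_nnreal_ennreal hF]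
  rfl

end Target

/-- A general, possibly signed, kernel `K(x, dy) = k(x, y) μ(dy) + r(x) δ_x(dy)` of total mass one
that is in detailed balance with `π`. -/
structure RevKernel {E : Type*} [MeasurableSpace E] {μ : Measure E} (T : Target μ) where
  k : E → E → ℝ≥0
  r : E → ℝ
  measurable_k : Measurable (Function.uncurry k)
  measurable_r : Measurable r
  abs_r_le : ∀ x, |r x| ≤ 1
  row_le : ∀ᵐ x ∂μ, ∫⁻ y, k x y ∂μ ≤ 2
  total : ∀ᵐ x ∂μ, (∫⁻ y, k x y ∂μ).toReal + r x = 1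
  balance : ∀ x y, T.dens x ≠ 0 → T.dens y ≠ 0 → T.dens x * k x y = T.dens y * k y x

/-- The subspace `L²₀(π)` of mean-zero functions in the complex Hilbert space `L²(π)`. -/
def L2zero {E : Type*} [MeasurableSpace E] {μ : Measure E} (T : Target μ) :
    Submodule ℂ (Lp ℂ 2 T.law) where
  carrier := {f | ∫ x, f x ∂T.law = 0}
  zero_mem' := by
    change ∫ x, (0 : Lp ℂ 2 T.law) x ∂T.law = 0
    rw [integral_congr_ae (Lp.coeFn_zero ℂ 2 T.law)]
    simp
  add_mem' := by
    intro f g hf hg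
    have hf' : ∫ x, f x ∂T.law = 0 := hf
    have hg' : ∫ x, g x ∂T.law = 0 := hg
    change ∫ x, (f + g : Lp ℂ 2 T.law) x ∂T.law = 0
    rw [integral_congr_ae (Lp.coeFn_add f g)]
    simp only [Pi.add_apply]
    rw [integral_add ((Lp.memLp f).integrable one_le_two) ((Lp.memLp g).integrable one_le_two),
      hf', hg', add_zero]
  smul_mem' := by
    intro c f hf
    have hf' : ∫ x, f x ∂T.law = 0 := hf
    change ∫ x, (c • f : Lp ℂ 2 T.law) x ∂T.law = 0
    rw [integral_congr_ae (Lp.coeFn_smul c f)]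
    simp only [Pi.smul_apply]
    rw [integral_smul, hf', smul_zero]

namespace RevKernel

variable {E : Type*} [MeasurableSpace E] {μ : Measure E} {T : Target μ} (K : RevKernel T)

/-- The action `K f (x) = ∫ f(y) K(x, dy)`. -/
def act (f : E → ℂ) (x : E) : ℂ := ∫ y, K.k x y • f y ∂μ + (K.r x : ℂ) * f x

lemma measurable_k_coe : Measurable (fun z : E × E => (K.k z.1 z.2 : ℝ≥0∞)) :=
  K.measurable_k.coe_nnreal_ennreal

lemma balance_ae : ∀ᵐ y ∂μ, ∀ᵐ x ∂μ,
    (T.dens x : ℝ≥0∞) * K.k x y = (T.dens y : ℝ≥0∞) * K.k y x := by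
  filter_upwards [T.ae_ne_zero] with y hy
  filter_upwards [T.ae_ne_zero] with x hx
  exact_mod_cast K.balance x y hx hy

/-- Schur test, weighted by `π`. -/
lemma lintegral_lintegral_le {F : E → ℝ≥0∞} (hF : Measurable F) :
    ∫⁻ x, (∫⁻ y, K.k x y * F y ∂μ) ∂T.law ≤ 2 * ∫⁻ y, F y ∂T.law := by
  have := T.sFinite
  have hk := K.measurable_k_coe
  have hk' : Measurable (fun z : E × E => (K.k z.2 z.1 : ℝ≥0∞)) := hk.comp measurable_swap
  have hd := T.measurable_dens.coe_nnreal_ennreal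
  rw [T.lintegral_law (Measurable.lintegral_prod_right (hk.mul (hF.comp measurable_snd))),
    T.lintegral_law hF]
  calc ∫⁻ x, (T.dens x : ℝ≥0∞) * ∫⁻ y, K.k x y * F y ∂μ ∂μ
      = ∫⁻ x, ∫⁻ y, (T.dens x : ℝ≥0∞) * (K.k x y * F y) ∂μ ∂μ := by
        refine lintegral_congr fun x => ?_
        exact (lintegral_const_mul _ ((hk.comp measurable_prodMk_left).mul hF)).symm
    _ = ∫⁻ y, ∫⁻ x, (T.dens x : ℝ≥0∞) * (K.k x y * F y) ∂μ ∂μ := by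
        refine lintegral_lintegral_swap ?_
        exact ((hd.comp measurable_fst).mul (hk.mul (hF.comp measurable_snd))).aemeasurable
    _ ≤ ∫⁻ y, 2 * ((T.dens y : ℝ≥0∞) * F y) ∂μ := by
        refine lintegral_mono_ae ?_
        filter_upwards [K.balance_ae, K.row_le] with y hy hr
        calc ∫⁻ x, (T.dens x : ℝ≥0∞) * (K.k x y * F y) ∂μ
            = ∫⁻ x, (T.dens y : ℝ≥0∞) * F y * K.k y x ∂μ := by
              refine lintegral_congr_ae (hy.mono fun x hx => ?_)
              change (T.dens x : ℝ≥0∞) * (K.k x y * F y) = (T.dens y : ℝ≥0∞) * F y * K.k y x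
              rw [← mul_assoc, hx]; ring
          _ = (T.dens y : ℝ≥0∞) * F y * ∫⁻ x, K.k y x ∂μ :=
              lintegral_const_mul _ (hk.comp measurable_prodMk_left)
          _ ≤ (T.dens y : ℝ≥0∞) * F y * 2 := by gcongr
          _ = _ := by ring
    _ = 2 * ∫⁻ y, (T.dens y : ℝ≥0∞) * F y ∂μ := lintegral_const_mul _ (hd.mul hF)

lemma sq_lintegral_le {F : E → ℝ≥0∞} (hF : Measurable F) :
    ∀ᵐ x ∂μ, (∫⁻ y, K.k x y * F y ∂μ) ^ (2 : ℝ) ≤ 2 * ∫⁻ y, K.k x y * F y ^ (2 : ℝ) ∂μ := by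
  filter_upwards [K.row_le] with x hx
  have hkx : Measurable (fun y => (K.k x y : ℝ≥0∞)) := K.measurable_k_coe.comp measurable_prodMk_left
  have h := ENNReal.lintegral_mul_le_Lp_mul_Lq (μ.withDensity fun y => (K.k x y : ℝ≥0∞))
    (Real.HolderConjugate.two_two) (f := F) (g := fun _ => 1) hF.aemeasurable aemeasurable_const
  simp only [Pi.mul_apply, mul_one, ENNReal.one_rpow] at h
  rw [lintegral_withDensity_eq_lintegral_mul _ hkx hF,
    lintegral_withDensity_eq_lintegral_mul _ hkx (hF.pow_const _),
    lintegral_withDensity_eq_lintegral_mul _ hkx measurable_const] at h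
  simp only [Pi.mul_apply, mul_one] at h
  calc (∫⁻ y, K.k x y * F y ∂μ) ^ (2 : ℝ)
      ≤ ((∫⁻ y, K.k x y * F y ^ (2 : ℝ) ∂μ) ^ (1 / 2 : ℝ)
          * (∫⁻ y, K.k x y ∂μ) ^ (1 / 2 : ℝ)) ^ (2 : ℝ) := by gcongr
    _ = (∫⁻ y, K.k x y * F y ^ (2 : ℝ) ∂μ) * ∫⁻ y, K.k x y ∂μ := by
        rw [ENNReal.mul_rpow_of_nonneg _ _ (by norm_num), ← ENNReal.rpow_mul, ← ENNReal.rpow_mul]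
        norm_num
    _ ≤ (∫⁻ y, K.k x y * F y ^ (2 : ℝ) ∂μ) * 2 := by gcongr
    _ = _ := mul_comm _ _

lemma eLpNorm_two {G : E → ℝ≥0∞} {ν : Measure E} :
    eLpNorm G 2 ν = (∫⁻ x, G x ^ (2 : ℝ) ∂ν) ^ (1 / 2 : ℝ) := by
  rw [eLpNorm_eq_lintegral_rpow_enorm_toReal (by norm_num) (by norm_num)]
  simp

lemma eLpNorm_lintegral_le {F : E → ℝ≥0∞} (hF : Measurable F) :
    eLpNorm (fun x => ∫⁻ y, K.k x y * F y ∂μ) 2 T.law ≤ 2 * eLpNorm F 2 T.law := by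
  rw [eLpNorm_two, eLpNorm_two]
  have hF2 : Measurable (fun y => F y ^ (2 : ℝ)) := hF.pow_const _
  have := T.sFinite
  have h : ∫⁻ x, (∫⁻ y, K.k x y * F y ∂μ) ^ (2 : ℝ) ∂T.law
      ≤ 2 ^ (2 : ℝ) * ∫⁻ y, F y ^ (2 : ℝ) ∂T.law := by
    calc ∫⁻ x, (∫⁻ y, K.k x y * F y ∂μ) ^ (2 : ℝ) ∂T.law
        ≤ ∫⁻ x, 2 * ∫⁻ y, K.k x y * F y ^ (2 : ℝ) ∂μ ∂T.law :=
          lintegral_mono_ae (T.law_ac.ae_le (K.sq_lintegral_le hF))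
      _ = 2 * ∫⁻ x, ∫⁻ y, K.k x y * F y ^ (2 : ℝ) ∂μ ∂T.law :=
          lintegral_const_mul _ (Measurable.lintegral_prod_right
            (K.measurable_k_coe.mul (hF2.comp measurable_snd)))
      _ ≤ 2 * (2 * ∫⁻ y, F y ^ (2 : ℝ) ∂T.law) := by
          gcongr; exact K.lintegral_lintegral_le hF2
      _ = _ := by
          rw [← mul_assoc]; congr 1
          rw [ENNReal.rpow_two, sq]
  calc _ ≤ (2 ^ (2 : ℝ) * ∫⁻ y, F y ^ (2 : ℝ) ∂T.law) ^ (1 / 2 : ℝ) := by gcongr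
    _ = _ := by
      rw [ENNReal.mul_rpow_of_nonneg _ _ (by norm_num), ← ENNReal.rpow_mul]
      norm_num

lemma measurable_kf {f : E → ℂ} (hf : Measurable f) :
    Measurable (fun z : E × E => K.k z.1 z.2 • f z.2) :=
  K.measurable_k.smul (hf.comp measurable_snd)

lemma enorm_kf (f : E → ℂ) (x y : E) : ‖K.k x y • f y‖ₑ = K.k x y * ‖f y‖ₑ := by
  have h : K.k x y • f y = ((K.k x y : ℝ) : ℂ) * f y := rfl
  rw [h, enorm_mul]
  congr 1
  rw [← ofReal_norm, Complex.norm_real, Real.norm_of_nonneg (K.k x y).coe_nonneg,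
    ENNReal.ofReal_coe_nnreal]

lemma measurable_act {f : E → ℂ} (hf : Measurable f) : Measurable (K.act f) := by
  have := T.sFinite
  have h : StronglyMeasurable (fun x => ∫ y, K.k x y • f y ∂μ) :=
    (K.measurable_kf hf).stronglyMeasurable.integral_prod_right
  exact h.measurable.add ((Complex.measurable_ofReal.comp K.measurable_r).mul hf)

lemma eLpNorm_act_le {f : E → ℂ} (hf : Measurable f) :
    eLpNorm (K.act f) 2 T.law ≤ 3 * eLpNorm f 2 T.law := by
  have := T.sFinite
  have h1 : StronglyMeasurable (fun x => ∫ y, K.k x y • f y ∂μ) :=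
    (K.measurable_kf hf).stronglyMeasurable.integral_prod_right
  have h2 : Measurable (fun x => (K.r x : ℂ) * f x) :=
    (Complex.measurable_ofReal.comp K.measurable_r).mul hf
  calc eLpNorm (K.act f) 2 T.law
      ≤ eLpNorm (fun x => ∫ y, K.k x y • f y ∂μ) 2 T.law
        + eLpNorm (fun x => (K.r x : ℂ) * f x) 2 T.law :=
        eLpNorm_add_le h1.aestronglyMeasurable h2.aestronglyMeasurable one_le_two
    _ ≤ 2 * eLpNorm f 2 T.law + eLpNorm f 2 T.law := by
        gcongr
        · refine le_trans (eLpNorm_mono_enorm (g := fun x => ∫⁻ y, K.k x y * ‖f y‖ₑ ∂μ)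
            fun x => ?_) ?_
          · refine (enorm_integral_le_lintegral_enorm _).trans (le_of_eq ?_)
            simp only [K.enorm_kf, enorm_eq_self]
          · refine (K.eLpNorm_lintegral_le hf.enorm).trans (le_of_eq ?_)
            rw [eLpNorm_enorm]
        · refine eLpNorm_mono fun x => ?_
          rw [norm_mul, Complex.norm_real, Real.norm_eq_abs]
          exact mul_le_of_le_one_left (norm_nonneg _) (K.abs_r_le x)
    _ = _ := by ring

lemma memLp_act {f : E → ℂ} (hf : Measurable f) (h : MemLp f 2 T.law) :
    MemLp (K.act f) 2 T.law :=
  ⟨(K.measurable_act hf).aestronglyMeasurable,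
    (K.eLpNorm_act_le hf).trans_lt (ENNReal.mul_lt_top (by norm_num) h.2)⟩

lemma integrable_ae {f : E → ℂ} (hf : Measurable f) (h : MemLp f 2 T.law) :
    ∀ᵐ x ∂μ, Integrable (fun y => K.k x y • f y) μ := by
  have := T.sFinite
  have h1 : ∫⁻ x, (∫⁻ y, K.k x y * ‖f y‖ₑ ∂μ) ∂T.law ≠ ∞ := by
    refine ((K.lintegral_lintegral_le hf.enorm).trans_lt
      (ENNReal.mul_lt_top (by norm_num) ?_)).ne
    exact (h.integrable one_le_two).2
  have h2 : Measurable (fun x => ∫⁻ y, K.k x y * ‖f y‖ₑ ∂μ) :=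
    Measurable.lintegral_prod_right (K.measurable_k_coe.mul (hf.enorm.comp measurable_snd))
  filter_upwards [T.ac_law.ae_le (ae_lt_top h2 h1)] with x hx
  refine ⟨((K.measurable_kf hf).comp measurable_prodMk_left).aestronglyMeasurable, ?_⟩
  simpa [HasFiniteIntegral, K.enorm_kf] using hx

lemma act_congr {f g : E → ℂ} (h : f =ᵐ[T.law] g) : K.act f =ᵐ[T.law] K.act g := by
  filter_upwards [h] with x hx
  unfold act
  rw [hx]
  congr 1
  refine integral_congr_ae ?_
  filter_upwards [T.ac_law.ae_le h] with y hy
  rw [hy]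

lemma measurable_coe (f : Lp ℂ 2 T.law) : Measurable (f : E → ℂ) :=
  (Lp.stronglyMeasurable f).measurable

lemma integral_act {f : E → ℂ} (hf : Measurable f) (h : MemLp f 2 T.law) :
    ∫ x, K.act f x ∂T.law = ∫ x, f x ∂T.law := by
  have := T.sFinite
  have hi := h.integrable one_le_two
  have hmr : Measurable (fun x => (K.r x : ℂ) * f x) :=
    (Complex.measurable_ofReal.comp K.measurable_r).mul hf
  have hir : Integrable (fun x => (K.r x : ℂ) * f x) T.law := by
    refine hi.mono hmr.aestronglyMeasurable (ae_of_all _ fun x => ?_)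
    rw [norm_mul, Complex.norm_real, Real.norm_eq_abs]
    exact mul_le_of_le_one_left (norm_nonneg _) (K.abs_r_le x)
  have hia : Integrable (K.act f) T.law := (K.memLp_act hf h).integrable one_le_two
  have hik : Integrable (fun x => ∫ y, K.k x y • f y ∂μ) T.law := by
    have := hia.sub hir
    refine this.congr (ae_of_all _ fun x => ?_)
    simp [act]
  have hdm := T.measurable_dens
  have hprod : Integrable (fun z : E × E => T.dens z.1 • (K.k z.1 z.2 • f z.2)) (μ.prod μ) := by
    have hm : Measurable (fun z : E × E => T.dens z.1 • (K.k z.1 z.2 • f z.2)) :=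
      (hdm.comp measurable_fst).smul (K.measurable_kf hf)
    refine ⟨hm.aestronglyMeasurable, ?_⟩
    rw [HasFiniteIntegral, lintegral_prod _ hm.enorm.aemeasurable]
    have e : ∀ x, ∫⁻ y, ‖T.dens x • (K.k x y • f y)‖ₑ ∂μ
        = (T.dens x : ℝ≥0∞) * ∫⁻ y, K.k x y * ‖f y‖ₑ ∂μ := by
      intro x
      refine Eq.trans (lintegral_congr fun y => ?_)
        (lintegral_const_mul _ ((K.measurable_k_coe.comp measurable_prodMk_left).mul hf.enorm))
      have h : T.dens x • (K.k x y • f y) = ((T.dens x : ℝ) : ℂ) * (K.k x y • f y) := rfl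
      rw [h, enorm_mul, K.enorm_kf]
      congr 1
      rw [← ofReal_norm, Complex.norm_real, Real.norm_of_nonneg (T.dens x).coe_nonneg,
        ENNReal.ofReal_coe_nnreal]
    simp only [e]
    rw [← T.lintegral_law (Measurable.lintegral_prod_right
      (K.measurable_k_coe.mul (hf.enorm.comp measurable_snd)))]
    exact (K.lintegral_lintegral_le hf.enorm).trans_lt (ENNReal.mul_lt_top (by norm_num) hi.2)
  have hlaw : ∀ g : E → ℂ, ∫ x, g x ∂T.law = ∫ x, T.dens x • g x ∂μ := fun g =>
    integral_withDensity_eq_integral_smul hdm g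
  have key : ∫ x, (∫ y, K.k x y • f y ∂μ) ∂T.law = ∫ y, f y - (K.r y : ℂ) * f y ∂T.law := by
    rw [hlaw, hlaw]
    calc ∫ x, T.dens x • ∫ y, K.k x y • f y ∂μ ∂μ
        = ∫ x, ∫ y, T.dens x • (K.k x y • f y) ∂μ ∂μ := by
          refine integral_congr_ae (ae_of_all _ fun x => ?_)
          exact (integral_const_mul ((T.dens x : ℝ) : ℂ) _).symm
      _ = ∫ y, ∫ x, T.dens x • (K.k x y • f y) ∂μ ∂μ := integral_integral_swap hprod
      _ = _ := by
          refine integral_congr_ae ?_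
          filter_upwards [T.ae_ne_zero, K.total] with y hy ht
          have e1 : ∫ x, T.dens x • (K.k x y • f y) ∂μ
              = ∫ x, ((K.k y x : ℝ) : ℂ) * (T.dens y • f y) ∂μ := by
            refine integral_congr_ae ?_
            filter_upwards [T.ae_ne_zero] with x hx
            have hb : ((T.dens x : ℝ) : ℂ) * ((K.k x y : ℝ) : ℂ)
                = ((T.dens y : ℝ) : ℂ) * ((K.k y x : ℝ) : ℂ) := by
              have := K.balance x y hx hy
              exact_mod_cast this
            change ((T.dens x : ℝ) : ℂ) * (((K.k x y : ℝ) : ℂ) * f y)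
              = ((K.k y x : ℝ) : ℂ) * (((T.dens y : ℝ) : ℂ) * f y)
            linear_combination f y * hb
          have e2 : ∫ x, ((K.k y x : ℝ) : ℂ) ∂μ = 1 - (K.r y : ℂ) := by
            have e3 : ∫ x, (K.k y x : ℝ) ∂μ = (∫⁻ x, K.k y x ∂μ).toReal := by
              have hm : Measurable (fun x => (K.k y x : ℝ)) :=
                (K.measurable_k.comp measurable_prodMk_left).coe_nnreal_real
              rw [integral_eq_lintegral_of_nonneg_ae (ae_of_all _ fun x => by positivity)
                hm.aestronglyMeasurable]
              simp
            have e4 : ∫ x, ((K.k y x : ℝ) : ℂ) ∂μ = ((∫ x, (K.k y x : ℝ) ∂μ : ℝ) : ℂ) :=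
              integral_ofReal
            have ht' : (∫⁻ x, K.k y x ∂μ).toReal = 1 - K.r y := by linarith
            rw [e4, e3, ht']
            push_cast; ring
          rw [e1, integral_mul_const, e2]
          change _ = ((T.dens y : ℝ) : ℂ) * (f y - (K.r y : ℂ) * f y)
          change _ * (((T.dens y : ℝ) : ℂ) * f y) = _
          ring
  calc ∫ x, K.act f x ∂T.law
      = ∫ x, (∫ y, K.k x y • f y ∂μ) ∂T.law + ∫ x, (K.r x : ℂ) * f x ∂T.law :=
        integral_add hik hir
    _ = _ := by rw [key, integral_sub hi hir]; ring

/-- The bounded operator on `L²(π)` induced by a kernel. -/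
def op : Lp ℂ 2 T.law →L[ℂ] Lp ℂ 2 T.law :=
  LinearMap.mkContinuous
    { toFun := fun f => (K.memLp_act (measurable_coe f) (Lp.memLp f)).toLp (K.act f)
      map_add' := by
        intro f g
        rw [← MemLp.toLp_add]
        refine MemLp.toLp_congr _ _ ((K.act_congr (Lp.coeFn_add f g)).trans ?_)
        filter_upwards [T.law_ac.ae_le (K.integrable_ae (measurable_coe f) (Lp.memLp f)),
          T.law_ac.ae_le (K.integrable_ae (measurable_coe g) (Lp.memLp g))] with x h1 h2
        simp only [act, Pi.add_apply, smul_add]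
        rw [integral_add h1 h2]; ring
      map_smul' := by
        intro c f
        rw [RingHom.id_apply, ← MemLp.toLp_const_smul]
        refine MemLp.toLp_congr _ _ ((K.act_congr (Lp.coeFn_smul c f)).trans ?_)
        refine ae_of_all _ fun x => ?_
        simp only [act, Pi.smul_apply, smul_comm _ c]
        rw [integral_smul]
        simp only [smul_eq_mul]; ring }
    3 (by
      intro f
      change ‖(K.memLp_act (measurable_coe f) (Lp.memLp f)).toLp (K.act f)‖ ≤ 3 * ‖f‖
      rw [Lp.norm_toLp, Lp.norm_def, show (3 : ℝ) = (3 : ℝ≥0∞).toReal by norm_num,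
        ← ENNReal.toReal_mul]
      exact ENNReal.toReal_mono (ENNReal.mul_ne_top (by norm_num) (Lp.eLpNorm_ne_top f))
        (K.eLpNorm_act_le (measurable_coe f)))

lemma coeFn_op (f : Lp ℂ 2 T.law) : K.op f =ᵐ[T.law] K.act f :=
  MemLp.coeFn_toLp (K.memLp_act (measurable_coe f) (Lp.memLp f))

lemma op_mem_L2zero {f : Lp ℂ 2 T.law} (hf : f ∈ L2zero T) : K.op f ∈ L2zero T := by
  change ∫ x, K.op f x ∂T.law = 0
  rw [integral_congr_ae (K.coeFn_op f), K.integral_act (measurable_coe f) (Lp.memLp f)]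
  exact hf

/-- The restriction of the operator `K` to `L²₀(π)`. -/
def opZero : L2zero T →L[ℂ] L2zero T :=
  K.op.restrict fun _ hf => K.op_mem_L2zero hf

/-- The spectrum `σ(K | L²₀(π))`, which is real as `K` is self-adjoint. -/
def spec : Set ℝ := {a | (a : ℂ) ∈ spectrum ℂ K.opZero}

/-- `λ(K) = inf σ(K | L²₀(π))`. -/
def specInf : ℝ := sInf K.spec

/-- `Λ(K) = sup σ(K | L²₀(π))`. -/
def specSup : ℝ := sSup K.spec

end RevKernel

/-- A Markov kernel `P` with stationary law `π`, such that `P(x, dy) = p(x, y) μ(dy)`. -/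
structure StationaryKernel {E : Type*} [MeasurableSpace E] {μ : Measure E} (T : Target μ) where
  kernel : Kernel E E
  isMarkov : IsMarkovKernel kernel
  invariant : Kernel.Invariant kernel T.law
  p : E → E → ℝ≥0
  measurable_p : Measurable (Function.uncurry p)
  kernel_eq : ∀ x, kernel x = μ.withDensity (fun y => (p x y : ℝ≥0∞))

namespace StationaryKernel

variable {E : Type*} [MeasurableSpace E] {μ : Measure E} {T : Target μ} (S : StationaryKernel T)

/-- The density of the time reversal `P*`, for which `π(dx) P*(x, dy) = π(dy) P(y, dx)`. -/
def pStar (x y : E) : ℝ≥0 := T.dens y * S.p y x / T.dens x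

/-- Acceptance probabilities of the Metropolis-Hastings chain with proposal `P` and target `π`. -/
def alpha (x y : E) : ℝ≥0 :=
  if 0 < T.dens x * S.p x y then min (T.dens y * S.p y x / (T.dens x * S.p x y)) 1 else 0

/-- Density `m₁ = α p`, which is `min (p*, p)`. -/
def m1 (x y : E) : ℝ≥0 := S.alpha x y * S.p x y

/-- Reject probability of the Metropolis-Hastings chain. -/
def r1 (x : E) : ℝ := 1 - (∫⁻ y, S.m1 x y ∂μ).toReal

/-- Density `m₂ = max (p*, p)`. -/
def m2 (x y : E) : ℝ≥0 := max (S.pStar x y) (S.p x y)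

lemma measurable_p_coe : Measurable (fun z : E × E => (S.p z.1 z.2 : ℝ≥0∞)) :=
  S.measurable_p.coe_nnreal_ennreal

lemma measurable_pStar : Measurable (Function.uncurry S.pStar) :=
  ((T.measurable_dens.comp measurable_snd).mul (S.measurable_p.comp measurable_swap)).div
    (T.measurable_dens.comp measurable_fst)

lemma measurable_m1 : Measurable (Function.uncurry S.m1) := by
  have h1 : Measurable (fun z : E × E => T.dens z.1 * S.p z.1 z.2) :=
    (T.measurable_dens.comp measurable_fst).mul S.measurable_p
  have h2 : Measurable (fun z : E × E => T.dens z.2 * S.p z.2 z.1) :=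
    (T.measurable_dens.comp measurable_snd).mul (S.measurable_p.comp measurable_swap)
  exact (Measurable.ite (measurableSet_lt measurable_const h1)
    ((h2.div h1).min measurable_const) measurable_const).mul S.measurable_p

lemma measurable_m2 : Measurable (Function.uncurry S.m2) :=
  S.measurable_pStar.max S.measurable_p

lemma dens_mul_m1 (x y : E) :
    T.dens x * S.m1 x y = min (T.dens y * S.p y x) (T.dens x * S.p x y) := by
  unfold m1 alpha
  split_ifs with h
  · rw [mul_left_comm, min_mul_of_nonneg _ _ h.le, div_mul_cancel₀ _ h.ne', one_mul]
  · have : T.dens x * S.p x y = 0 := by simpa only [pos_iff_ne_zero, not_not] using h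
    simp [this]

lemma m1_eq {x : E} (hx : T.dens x ≠ 0) (y : E) : S.m1 x y = min (S.pStar x y) (S.p x y) := by
  have h := S.dens_mul_m1 x y
  have hp : T.dens y * S.p y x = T.dens x * S.pStar x y := by
    unfold pStar; field_simp
  rw [hp, ← mul_min_of_nonneg _ _ zero_le] at h
  exact mul_left_cancel₀ hx h

lemma dens_mul_m2 {x : E} (hx : T.dens x ≠ 0) (y : E) :
    T.dens x * S.m2 x y = max (T.dens y * S.p y x) (T.dens x * S.p x y) := by
  have hp : T.dens y * S.p y x = T.dens x * S.pStar x y := by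
    unfold pStar; field_simp
  rw [hp, ← mul_max_of_nonneg _ _ (zero_le)]
  rfl

lemma m1_le (x y : E) : S.m1 x y ≤ S.p x y := by
  unfold m1
  refine mul_le_of_le_one_left (zero_le) ?_
  unfold alpha
  split_ifs
  · exact min_le_right _ _
  · exact zero_le_one

lemma m1_add_m2 {x : E} (hx : T.dens x ≠ 0) (y : E) :
    S.m1 x y + S.m2 x y = S.pStar x y + S.p x y := by
  rw [S.m1_eq hx]; exact min_add_max _ _

lemma lintegral_p (x : E) : ∫⁻ y, S.p x y ∂μ = 1 := by
  have := S.isMarkov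
  have h : S.kernel x Set.univ = 1 := measure_univ
  rw [S.kernel_eq x] at h
  simpa using h

lemma lintegral_dens_mul_p : ∀ᵐ y ∂μ, ∫⁻ x, (T.dens x : ℝ≥0∞) * S.p x y ∂μ = T.dens y := by
  have := T.sFinite
  have hd := T.measurable_dens.coe_nnreal_ennreal
  have hm : Measurable (fun z : E × E => (T.dens z.1 : ℝ≥0∞) * S.p z.1 z.2) :=
    (hd.comp measurable_fst).mul S.measurable_p_coe
  have hg : Measurable (fun y => ∫⁻ x, (T.dens x : ℝ≥0∞) * S.p x y ∂μ) :=
    Measurable.lintegral_prod_left hm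
  have h : μ.withDensity (fun y => ∫⁻ x, (T.dens x : ℝ≥0∞) * S.p x y ∂μ) = T.law := by
    ext A hA
    have hb : T.law.bind S.kernel A = T.law A := by rw [S.invariant.def]
    rw [Measure.bind_apply hA (Kernel.aemeasurable _),
      T.lintegral_law (Kernel.measurable_coe _ hA)] at hb
    rw [← hb, withDensity_apply _ hA, lintegral_lintegral_swap
      (f := fun y x => (T.dens x : ℝ≥0∞) * S.p x y) (hm.comp measurable_swap).aemeasurable]
    refine lintegral_congr fun x => ?_
    rw [S.kernel_eq x, withDensity_apply _ hA]
    exact lintegral_const_mul _ (S.measurable_p_coe.comp measurable_prodMk_left)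
  have hfin : ∫⁻ y, ∫⁻ x, (T.dens x : ℝ≥0∞) * S.p x y ∂μ ∂μ ≠ ∞ := by
    have : μ.withDensity (fun y => ∫⁻ x, (T.dens x : ℝ≥0∞) * S.p x y ∂μ) Set.univ = 1 := by
      rw [h]; exact measure_univ
    rw [withDensity_apply _ MeasurableSet.univ, Measure.restrict_univ] at this
    simp [this]
  exact (withDensity_eq_iff hg.aemeasurable hd.aemeasurable hfin).1 h

lemma lintegral_pStar : ∀ᵐ x ∂μ, ∫⁻ y, S.pStar x y ∂μ = 1 := by
  filter_upwards [S.lintegral_dens_mul_p, T.ae_ne_zero] with x h hx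
  have hx' : (T.dens x : ℝ≥0∞) ≠ 0 := by simpa using hx
  have e : ∀ y, (S.pStar x y : ℝ≥0∞) = (T.dens x : ℝ≥0∞)⁻¹ * ((T.dens y : ℝ≥0∞) * S.p y x) := by
    intro y
    rw [pStar, ENNReal.coe_div hx, ENNReal.div_eq_inv_mul, ENNReal.coe_mul]
  simp only [e]
  have hm : Measurable (fun y => (T.dens y : ℝ≥0∞) * S.p y x) :=
    T.measurable_dens.coe_nnreal_ennreal.mul (S.measurable_p_coe.comp measurable_prodMk_right)
  rw [lintegral_const_mul _ hm, h]
  exact ENNReal.inv_mul_cancel hx' ENNReal.coe_ne_top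

lemma lintegral_m1_le (x : E) : ∫⁻ y, S.m1 x y ∂μ ≤ 1 := by
  rw [← S.lintegral_p x]
  exact lintegral_mono fun y => ENNReal.coe_le_coe.2 (S.m1_le x y)

lemma lintegral_m1_add_m2 :
    ∀ᵐ x ∂μ, ∫⁻ y, S.m1 x y ∂μ + ∫⁻ y, S.m2 x y ∂μ = 2 := by
  filter_upwards [S.lintegral_pStar, T.ae_ne_zero] with x h hx
  have m1m : Measurable (fun y => (S.m1 x y : ℝ≥0∞)) :=
    (S.measurable_m1.comp measurable_prodMk_left).coe_nnreal_ennreal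
  have pm : Measurable (fun y => (S.pStar x y : ℝ≥0∞)) :=
    (S.measurable_pStar.comp measurable_prodMk_left).coe_nnreal_ennreal
  rw [← lintegral_add_left m1m]
  have e : ∀ y, (S.m1 x y : ℝ≥0∞) + S.m2 x y = (S.pStar x y : ℝ≥0∞) + S.p x y := fun y => by
    exact_mod_cast S.m1_add_m2 hx y
  simp only [e]
  rw [lintegral_add_left pm, h, S.lintegral_p x, one_add_one_eq_two]

lemma abs_r1_le (x : E) : |S.r1 x| ≤ 1 := by
  have h : (∫⁻ y, S.m1 x y ∂μ).toReal ≤ 1 := by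
    simpa using ENNReal.toReal_mono ENNReal.one_ne_top (S.lintegral_m1_le x)
  have h0 : 0 ≤ (∫⁻ y, S.m1 x y ∂μ).toReal := ENNReal.toReal_nonneg
  unfold r1
  rw [abs_le]; constructor <;> linarith

lemma measurable_r1 : Measurable S.r1 := by
  have := T.sFinite
  have h : Measurable (fun x => ∫⁻ y, S.m1 x y ∂μ) :=
    Measurable.lintegral_prod_right S.measurable_m1.coe_nnreal_ennreal
  exact measurable_const.sub h.ennreal_toReal

/-- The first Metropolis-Hastings kernel `M₁(P)(x, dy) = m₁(x, y) μ(dy) + r₁(x) δ_x(dy)`. -/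
def M1 : RevKernel T where
  k := S.m1
  r := S.r1
  measurable_k := S.measurable_m1
  measurable_r := S.measurable_r1
  abs_r_le := S.abs_r1_le
  row_le := ae_of_all _ fun x => (S.lintegral_m1_le x).trans one_le_two
  total := ae_of_all _ fun x => by unfold r1; ring
  balance := fun x y _ _ => by rw [S.dens_mul_m1, S.dens_mul_m1, min_comm]

/-- The second Metropolis-Hastings kernel `M₂(P)(x, dy) = m₂(x, y) μ(dy) - r₁(x) δ_x(dy)`. -/
def M2 : RevKernel T where
  k := S.m2
  r := fun x => - S.r1 x
  measurable_k := S.measurable_m2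
  measurable_r := S.measurable_r1.neg
  abs_r_le := fun x => by rw [abs_neg]; exact S.abs_r1_le x
  row_le := by
    filter_upwards [S.lintegral_m1_add_m2] with x hx
    rw [← hx]; exact le_add_self
  total := by
    filter_upwards [S.lintegral_m1_add_m2] with x hx
    have h1 : ∫⁻ y, S.m1 x y ∂μ ≠ ∞ := ((S.lintegral_m1_le x).trans_lt ENNReal.one_lt_top).ne
    have h2 : ∫⁻ y, S.m2 x y ∂μ ≠ ∞ := by
      intro h; rw [h] at hx; simp at hx
    have := congrArg ENNReal.toReal hx
    rw [ENNReal.toReal_add h1 h2] at this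
    simp only [ENNReal.toReal_ofNat] at this
    unfold r1; linarith
  balance := fun x y hx hy => by rw [S.dens_mul_m2 hx, S.dens_mul_m2 hy, max_comm]

lemma lintegral_comp_density (R : StationaryKernel T) (x : E) {A : Set E} (hA : MeasurableSet A) :
    (R.kernel ∘ₖ S.kernel) x A
      = ∫⁻ y in A, ∫⁻ z, (S.p x z : ℝ≥0∞) * R.p z y ∂μ ∂μ := by
  have := T.sFinite
  have hS : Measurable (fun z => (S.p x z : ℝ≥0∞)) := S.measurable_p_coe.comp measurable_prodMk_left
  rw [Kernel.comp_apply' _ _ _ hA, S.kernel_eq x,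
    lintegral_withDensity_eq_lintegral_mul _ hS (Kernel.measurable_coe _ hA),
    lintegral_lintegral_swap (f := fun y z => (S.p x z : ℝ≥0∞) * R.p z y)
      ((hS.comp measurable_snd).mul
        (R.measurable_p_coe.comp measurable_swap)).aemeasurable]
  refine lintegral_congr fun z => ?_
  rw [Pi.mul_apply, R.kernel_eq z, withDensity_apply _ hA]
  exact (lintegral_const_mul _ (R.measurable_p_coe.comp measurable_prodMk_left)).symm

/-- The composition (product) of two kernels, with its density. -/
def comp (R : StationaryKernel T) : StationaryKernel T where
  kernel := R.kernel ∘ₖ S.kernel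
  isMarkov := by
    have := S.isMarkov
    have := R.isMarkov
    infer_instance
  invariant := R.invariant.comp S.invariant
  p := fun x y => (∫⁻ z, (S.p x z : ℝ≥0∞) * R.p z y ∂μ).toNNReal
  measurable_p := by
    have := T.sFinite
    have h : Measurable (fun w : (E × E) × E => (S.p w.1.1 w.2 : ℝ≥0∞) * R.p w.2 w.1.2) :=
      (S.measurable_p_coe.comp (measurable_fst.fst.prodMk measurable_snd)).mul
        (R.measurable_p_coe.comp (measurable_snd.prodMk measurable_fst.snd))
    exact (Measurable.lintegral_prod_right h).ennreal_toNNReal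
  kernel_eq := by
    have := T.sFinite
    have := S.isMarkov
    have := R.isMarkov
    intro x
    have h : Measurable (fun y => ∫⁻ z, (S.p x z : ℝ≥0∞) * R.p z y ∂μ) := by
      have h' : Measurable (fun w : E × E => (S.p x w.2 : ℝ≥0∞) * R.p w.2 w.1) :=
        (S.measurable_p_coe.comp (measurable_const.prodMk measurable_snd)).mul
          (R.measurable_p_coe.comp measurable_swap)
      exact Measurable.lintegral_prod_right h'
    have h1 : ∫⁻ y, ∫⁻ z, (S.p x z : ℝ≥0∞) * R.p z y ∂μ ∂μ = 1 := by
      have := S.lintegral_comp_density R x MeasurableSet.univ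
      rw [Measure.restrict_univ] at this
      rw [← this]; exact measure_univ
    have e : (R.kernel ∘ₖ S.kernel) x
        = μ.withDensity (fun y => ∫⁻ z, (S.p x z : ℝ≥0∞) * R.p z y ∂μ) := by
      ext A hA
      rw [S.lintegral_comp_density R x hA, withDensity_apply _ hA]
    rw [e]
    refine withDensity_congr_ae ?_
    filter_upwards [ae_lt_top h (by simp [h1])] with y hy
    exact (ENNReal.coe_toNNReal hy.ne).symm

/-- The kernel `P^(n+1)` with its density. -/
def iter : ℕ → StationaryKernel T
  | 0 => S
  | n + 1 => (iter n).comp S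

/-- The `n`-step kernel `P^n` for `n ≥ 1`, with its density. -/
def pow (n : ℕ+) : StationaryKernel T := S.iter n.natPred

lemma kernel_pow (n : ℕ+) : (S.pow n).kernel = S.kernel ^ (n : ℕ) := by
  have h : ∀ k, (S.iter k).kernel = S.kernel ^ (k + 1) := by
    intro k
    induction k with
    | zero => simp [iter]
    | succ k ih =>
      rw [pow_succ' S.kernel (k + 1), ← ih]
      rfl
  rw [pow, h, PNat.natPred_add_one]

/-- The set `𝒞` of those `n ≥ 1` for which `|λ(M₂(P^n))| < 1` and `Λ(M₁(P^n)) < 1`. -/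
def goodTimes : Set ℕ+ :=
  {n | |(S.pow n).M2.specInf| < 1 ∧ (S.pow n).M1.specSup < 1}

open Classical in
/-- `β^MH`. A negative `Λ(M₁(P^n))` has no real `n`-th root in general; it never contributes to the
supremum, as then `|Λ(M₁(P^n))| ≤ |λ(M₂(P^n))|`, and is replaced by `0`. -/
def betaMH : ℝ :=
  if S.goodTimes = ∅ then 1
  else sSup {b | ∃ n ∈ S.goodTimes, b = |(S.pow n).M2.specInf| ^ (1 / (n : ℝ)) ∨
    b = (max (S.pow n).M1.specSup 0) ^ (1 / (n : ℝ))}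

/-- The MH-spectral gap `γ^MH = 1 - β^MH`. -/
def gammaMH : ℝ := 1 - S.betaMH

end StationaryKernel

/-- `X` is a time-homogeneous Markov chain under `Pr` with kernel `P` and initial law `ν`: the
conditional law of `X (n + 1)` given `X 0, …, X n` is `P (X n, ·)`. -/
structure IsMarkovChain {Ω E : Type*} [MeasurableSpace Ω] [MeasurableSpace E] (Pr : Measure Ω)
    (X : ℕ → Ω → E) (P : Kernel E E) (ν : Measure E) : Prop where
  measurable : ∀ n, Measurable (X n)
  initial : Pr.map (X 0) = ν
  markov : ∀ n, ∀ A : Set E, MeasurableSet A → ∀ B : Set Ω,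
    MeasurableSet[⨆ i : Fin (n + 1), MeasurableSpace.comap (X i) inferInstance] B →
    Pr (B ∩ X (n + 1) ⁻¹' A) = ∫⁻ ω in B, P (X n ω) A ∂Pr

/-- The variance `𝔼 |Z - 𝔼 Z|²` of a complex random variable. -/
def cVar {Ω : Type*} [MeasurableSpace Ω] (Pr : Measure Ω) (Z : Ω → ℂ) : ℝ :=
  ∫ ω, ‖Z ω - ∫ ω', Z ω' ∂Pr‖ ^ 2 ∂Pr

end MHGap
end

/-! Everything rests on the numerical radius of the powers of P on L²₀(π): for a good time n, |⟨f,
Pⁿf⟩| ≤ βⁿ‖f‖² with β = β^MH (`norm_inner_opZero_pow_le`). This needs no reversibility of P. It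
comes from the two Metropolis-Hastings kernels, and a Hilbert space argument turns it into variance
bounds.

For a single kernel (`norm_inner_op_le`), split the flow π(x)p(x,y) into the symmetric part
π(x)m₁(x,y) and an excess. With Q and Z the forms of these two parts at f and r = ∫ r₁|f|² dπ, the
forms of P, M₁, M₂ at f are Q + Z, Q + r and Q + 2 Re Z - r, where Q is real. By stationarity both
marginals of the excess are r₁π, so |Z| ≤ r. If b bounds the two spectra and c = b‖f‖², then Q + r ≤
c and Q + 2 Re Z - r ≥ -c; together with r ≤ c these force |Q + Z| ≤ c. The remaining fact r₁ ≤ b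
a.e. (`ae_r1_le`) is a question about atoms: M₁ tested on centered indicators shows that {r₁ > b'},
for b' > b, has no subsets of small positive measure, so it contains an atom if it is not null. On
an atom the flow is symmetric, hence m₁ = m₂ there, and comparing M₁ with M₂ on its indicator gives
a contradiction.

For the variances, the isometries Vᵢ : f ↦ f(Xᵢ) satisfy ⟨Vᵢx, Vⱼy⟩ = ⟨x, P^(j-i)y⟩ for i ≤ j. A
martingale decomposition bounds ‖∑ Vᵢxᵢ‖² by (1+b)/(1-b) ∑‖xᵢ‖² when the numerical radius is at most
b < 1 (`norm_sq_sum_le`). Applied to P^k along residue classes modulo a good time k ≤ |𝒞ᶜ| + 1, this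
gives (1) and (3). For (2) the Poisson equation is solved twice, g - Pg = f and h - Ph = g; then the
variance is n(‖g‖² - ‖Pg‖²) plus a bounded remainder (`norm_sq_sum_eq_poisson`). Each solution costs
one factor of the bracket in (2) (`exists_sub_eq_of_numericalRadius`), whence the square. -/

namespace MHGap

open scoped ComplexConjugate

/-! ### Second moments of sums from a numerical radius bound -/

section Hilbert

variable {H : Type*} [NormedAddCommGroup H] [InnerProductSpace ℂ H]

/-- A bound on the numerical radius of `B` passes to `B ⊗ S` with `S` the nilpotent shift. -/
lemma re_sum_inner_succ_le (B : H →L[ℂ] H) {b : ℝ} (hB : ∀ x, ‖inner ℂ x (B x)‖ ≤ b * ‖x‖ ^ 2)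
    (y : ℕ → H) (n : ℕ) :
    ∑ i ∈ Finset.range n, (inner ℂ (y i) (B (y (i + 1)))).re
      ≤ b * ∑ i ∈ Finset.range (n + 1), ‖y i‖ ^ 2 := by
  -- With this modulus the congruences j ≡ i and j ≡ i + 1 between indices in 0, …, n are
  -- equalities; modulus n + 1 would wrap n + 1 round to 0.
  set N : ℕ := n + 2 with hN
  let ψ : AddChar (ZMod N) ℂ := ZMod.stdAddChar
  have hψ : ψ.IsPrimitive := ZMod.isPrimitive_stdAddChar N
  -- A discrete Fourier transform of `y`. The bound applies to each `g a`; summing ⟨g a, B (g a)⟩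
  -- against the unimodular weight ψ(-a) selects the pairs (i, i + 1), while Parseval gives ∑‖g a‖²
  -- = N ∑‖y i‖².
  let g : ZMod N → H := fun a => ∑ i ∈ Finset.range (n + 1), ψ (a * (i : ZMod N)) • y i
  have hsum : ∀ (F : ℕ → ℕ → ℂ) (c : ZMod N),
      ∑ a : ZMod N, ψ (-(a * c)) * ∑ i ∈ Finset.range (n + 1), ∑ j ∈ Finset.range (n + 1),
        conj (ψ (a * (i : ZMod N))) * (ψ (a * (j : ZMod N)) * F i j)
      = ∑ i ∈ Finset.range (n + 1), ∑ j ∈ Finset.range (n + 1),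
        (if (j : ZMod N) = i + c then (N : ℂ) else 0) * F i j := by
    intro F c
    simp_rw [Finset.mul_sum]
    rw [Finset.sum_comm]
    refine Finset.sum_congr rfl fun i _ => ?_
    rw [Finset.sum_comm]
    refine Finset.sum_congr rfl fun j _ => ?_
    have h := AddChar.sum_mulShift ((j : ZMod N) - i - c) hψ
    rw [ZMod.card] at h
    have e : (if (j : ZMod N) = i + c then (N : ℂ) else 0)
        = ∑ x, ψ (x * ((j : ZMod N) - i - c)) := by
      rw [h]; simp only [sub_sub, sub_eq_zero]; split_ifs <;> simp
    rw [e, Finset.sum_mul]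
    refine Finset.sum_congr rfl fun a _ => ?_
    rw [← AddChar.map_neg_eq_conj, ← mul_assoc, ← mul_assoc, ← AddChar.map_add_eq_mul,
      ← AddChar.map_add_eq_mul]
    congr 2; ring
  have hlt : ∀ i ∈ Finset.range (n + 1), ∀ j ∈ Finset.range (n + 1), ∀ e ≤ 1,
      ((j : ZMod N) = i + (e : ℕ) ↔ j = i + e) := by
    intro i hi j hj e he
    rw [Finset.mem_range] at hi hj
    rw [← Nat.cast_add, ZMod.natCast_eq_natCast_iff', Nat.mod_eq_of_lt (by omega),
      Nat.mod_eq_of_lt (by omega)]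
  have hinner : ∀ (C : H →L[ℂ] H) (a : ZMod N), inner ℂ (g a) (C (g a))
      = ∑ i ∈ Finset.range (n + 1), ∑ j ∈ Finset.range (n + 1),
        conj (ψ (a * (i : ZMod N))) * (ψ (a * (j : ZMod N)) * inner ℂ (y i) (C (y j))) := by
    intro C a
    simp only [g, map_sum, map_smul, sum_inner, inner_sum, inner_smul_left, inner_smul_right,
      Finset.mul_sum]
    rw [Finset.sum_comm]
    refine Finset.sum_congr rfl fun i _ => Finset.sum_congr rfl fun j _ => ?_
    ring
  have hnorm : ∑ a : ZMod N, ‖g a‖ ^ 2 = N * ∑ i ∈ Finset.range (n + 1), ‖y i‖ ^ 2 := by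
    have h := hsum (fun i j => inner ℂ (y i) (y j)) 0
    simp only [mul_zero, neg_zero, AddChar.map_zero_eq_one, one_mul, add_zero] at h
    have h2 : ∀ a, inner ℂ (g a) (g a) = _ := fun a => hinner (ContinuousLinearMap.id ℂ H) a
    simp only [ContinuousLinearMap.id_apply] at h2
    simp_rw [← h2, inner_self_eq_norm_sq_to_K] at h
    have h3 : ∑ i ∈ Finset.range (n + 1), ∑ j ∈ Finset.range (n + 1),
        (if (j : ZMod N) = i then (N : ℂ) else 0) * inner ℂ (y i) (y j)
        = ∑ i ∈ Finset.range (n + 1), (N : ℂ) * (‖y i‖ : ℂ) ^ 2 := by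
      refine Finset.sum_congr rfl fun i hi => ?_
      rw [Finset.sum_eq_single i]
      · simp [inner_self_eq_norm_sq_to_K]
      · intro j hj hji
        have := hlt i hi j hj 0 zero_le_one
        simp only [Nat.cast_zero, add_zero] at this
        rw [if_neg (by rwa [this]), zero_mul]
      · exact fun h => absurd hi h
    rw [h3, ← Finset.mul_sum] at h
    apply Complex.ofReal_injective
    push_cast
    exact h
  have hshift : ∑ a : ZMod N, ψ (-a) * inner ℂ (g a) (B (g a))
      = N * ∑ i ∈ Finset.range n, inner ℂ (y i) (B (y (i + 1))) := by
    have h := hsum (fun i j => inner ℂ (y i) (B (y j))) 1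
    simp only [mul_one] at h
    simp_rw [← hinner B] at h
    rw [h, Finset.sum_range_succ, Finset.mul_sum]
    have h0 : ∑ j ∈ Finset.range (n + 1), (if (j : ZMod N) = n + 1 then (N : ℂ) else 0) *
        inner ℂ (y n) (B (y j)) = 0 := by
      refine Finset.sum_eq_zero fun j hj => ?_
      have := hlt n (by simp) j hj 1 le_rfl
      rw [Nat.cast_one] at this
      rw [if_neg, zero_mul]
      rw [this]
      rw [Finset.mem_range] at hj
      omega
    rw [h0, add_zero]
    refine Finset.sum_congr rfl fun i hi => ?_
    rw [Finset.mem_range] at hi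
    have hi' : i ∈ Finset.range (n + 1) := Finset.mem_range.2 (by omega)
    rw [Finset.sum_eq_single (i + 1)]
    · rw [if_pos (by push_cast; rfl)]
    · intro j hj hji
      have := hlt i hi' j hj 1 le_rfl
      rw [Nat.cast_one] at this
      rw [if_neg (by rwa [this]), zero_mul]
    · intro h; exact absurd (Finset.mem_range.2 (by omega)) h
  have key : (N : ℝ) * ∑ i ∈ Finset.range n, (inner ℂ (y i) (B (y (i + 1)))).re
      ≤ N * (b * ∑ i ∈ Finset.range (n + 1), ‖y i‖ ^ 2) := by
    have e : (N : ℝ) * ∑ i ∈ Finset.range n, (inner ℂ (y i) (B (y (i + 1)))).re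
        = (∑ a : ZMod N, ψ (-a) * inner ℂ (g a) (B (g a))).re := by
      rw [hshift, ← Complex.re_sum]
      simp
    rw [e, Complex.re_sum]
    calc _ ≤ ∑ a : ZMod N, b * ‖g a‖ ^ 2 := by
          refine Finset.sum_le_sum fun a _ => (Complex.re_le_norm _).trans ?_
          rw [norm_mul, AddChar.norm_apply, one_mul]
          exact hB _
      _ = _ := by rw [← Finset.mul_sum, hnorm]; ring
  exact le_of_mul_le_mul_left key (by positivity)

variable {K : Type*} [NormedAddCommGroup K] [InnerProductSpace ℂ K]

/-- Decomposition into orthogonal increments. -/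
lemma norm_sq_sum_eq {V : ℕ → H →ₗᵢ[ℂ] K} {B : H →L[ℂ] H}
    (hV : ∀ i j, i ≤ j → ∀ x y, inner ℂ (V i x) (V j y) = inner ℂ x ((B ^ (j - i)) y))
    (y : ℕ → H) (n : ℕ) :
    ‖∑ i ∈ Finset.range n, V i (y i - B (y (i + 1))) + V n (y n)‖ ^ 2
      = ‖y 0‖ ^ 2 + ∑ i ∈ Finset.range n, (‖y (i + 1)‖ ^ 2 - ‖B (y (i + 1))‖ ^ 2) := by
  induction n with
  | zero => simp
  | succ n ih =>
    -- The increment V (n+1) y - V n (B y) is a martingale difference, orthogonal to the whole past,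
    -- so its squared norm simply adds.
    have horth : ∀ i ≤ n, ∀ x, inner ℂ (V i x) (V (n + 1) (y (n + 1)) - V n (B (y (n + 1)))) = 0 := by
      intro i hi x
      rw [inner_sub_right, hV i (n + 1) (by omega), hV i n hi, Nat.succ_sub hi, Nat.succ_eq_add_one,
        pow_succ, mul_apply_eq_comp, sub_self]
    have e : ∑ i ∈ Finset.range (n + 1), V i (y i - B (y (i + 1))) + V (n + 1) (y (n + 1))
        = (∑ i ∈ Finset.range n, V i (y i - B (y (i + 1))) + V n (y n))
          + (V (n + 1) (y (n + 1)) - V n (B (y (n + 1)))) := by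
      rw [Finset.sum_range_succ, map_sub]; abel
    have h0 : inner ℂ (∑ i ∈ Finset.range n, V i (y i - B (y (i + 1))) + V n (y n))
        (V (n + 1) (y (n + 1)) - V n (B (y (n + 1)))) = 0 := by
      rw [inner_add_left, sum_inner, horth n le_rfl, add_zero]
      exact Finset.sum_eq_zero fun i hi => horth i (Finset.mem_range.1 hi).le _
    have h1 : ‖V (n + 1) (y (n + 1)) - V n (B (y (n + 1)))‖ ^ 2
        = ‖y (n + 1)‖ ^ 2 - ‖B (y (n + 1))‖ ^ 2 := by
      have h2 : V (n + 1) (y (n + 1)) = V n (B (y (n + 1)))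
          + (V (n + 1) (y (n + 1)) - V n (B (y (n + 1)))) := by abel
      have h3 := norm_add_sq_eq_norm_sq_add_norm_sq_of_inner_eq_zero _ _
        (horth n le_rfl (B (y (n + 1))))
      rw [← h2, (V _).norm_map, (V _).norm_map] at h3
      nlinarith [h3]
    have h4 := norm_add_sq_eq_norm_sq_add_norm_sq_of_inner_eq_zero _ _ h0
    rw [e, sq, h4, ← sq, ← sq, ih, h1, Finset.sum_range_succ]
    ring

/-- In terms of the martingale variables y the left side is Y - t and ∑‖x i‖² is Y - 2ρ + t, so the
claim is (1 + b)ρ ≤ bY + t. This follows from ρ ≤ bY, the numerical radius bound, and ρ² ≤ Yt,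
Cauchy-Schwarz. -/
lemma norm_sq_sum_le {V : ℕ → H →ₗᵢ[ℂ] K} {B : H →L[ℂ] H}
    (hV : ∀ i j, i ≤ j → ∀ x y, inner ℂ (V i x) (V j y) = inner ℂ x ((B ^ (j - i)) y))
    {b : ℝ} (hb0 : 0 ≤ b) (hb1 : b < 1) (hB : ∀ x, ‖inner ℂ x (B x)‖ ≤ b * ‖x‖ ^ 2)
    (x : ℕ → H) (n : ℕ) :
    ‖∑ i ∈ Finset.range n, V i (x i)‖ ^ 2
      ≤ (1 + b) / (1 - b) * ∑ i ∈ Finset.range n, ‖x i‖ ^ 2 := by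
  rcases n with - | n
  · simp
  -- The solution of the backward recursion y i = x i + B (y (i + 1)) that ends with y n = x n.
  let y : ℕ → H := fun i => ∑ j ∈ Finset.Icc i n, (B ^ (j - i)) (x j)
  have hyn : y n = x n := by simp [y]
  have hy : ∀ i < n, y i - B (y (i + 1)) = x i := by
    intro i hi
    simp only [y]
    rw [← Finset.add_sum_Ioc_eq_sum_Icc hi.le, map_sum]
    have : Finset.Ioc i n = Finset.Icc (i + 1) n := by ext; simp
    rw [this, sub_eq_iff_eq_add]
    congr 1
    · simp
    · refine Finset.sum_congr rfl fun j hj => ?_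
      rw [Finset.mem_Icc] at hj
      rw [← mul_apply_eq_comp, ← pow_succ']
      congr 2; omega
  have hsum : ∑ i ∈ Finset.range (n + 1), V i (x i)
      = ∑ i ∈ Finset.range n, V i (y i - B (y (i + 1))) + V n (y n) := by
    rw [Finset.sum_range_succ, hyn]
    congr 1
    exact Finset.sum_congr rfl fun i hi => by rw [hy i (Finset.mem_range.1 hi)]
  set Y := ∑ i ∈ Finset.range (n + 1), ‖y i‖ ^ 2 with hY
  set t := ∑ i ∈ Finset.range n, ‖B (y (i + 1))‖ ^ 2 with ht
  set ρ := ∑ i ∈ Finset.range n, (inner ℂ (y i) (B (y (i + 1)))).re with hρ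
  have hL : ‖∑ i ∈ Finset.range (n + 1), V i (x i)‖ ^ 2 = Y - t := by
    rw [hsum, norm_sq_sum_eq hV, hY, Finset.sum_range_succ', Finset.sum_sub_distrib]; ring
  have hx : ∑ i ∈ Finset.range (n + 1), ‖x i‖ ^ 2 = Y - 2 * ρ + t := by
    have : ∀ i ∈ Finset.range n, ‖x i‖ ^ 2
        = ‖y i‖ ^ 2 - 2 * (inner ℂ (y i) (B (y (i + 1)))).re + ‖B (y (i + 1))‖ ^ 2 := by
      intro i hi
      rw [← hy i (Finset.mem_range.1 hi), @norm_sub_sq ℂ]; rfl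
    rw [Finset.sum_range_succ, Finset.sum_congr rfl this, Finset.sum_add_distrib,
      Finset.sum_sub_distrib, ← Finset.mul_sum, hY, Finset.sum_range_succ, hyn]
    ring
  have hρY : ρ ≤ b * Y := re_sum_inner_succ_le B hB y n
  have ht0 : 0 ≤ t := Finset.sum_nonneg fun _ _ => by positivity
  have hY0 : 0 ≤ Y := Finset.sum_nonneg fun _ _ => by positivity
  have hρ2 : ρ ^ 2 ≤ Y * t := by
    have h1 : |ρ| ≤ ∑ i ∈ Finset.range n, ‖y i‖ * ‖B (y (i + 1))‖ :=
      (Finset.abs_sum_le_sum_abs _ _).trans (Finset.sum_le_sum fun i _ =>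
        (Complex.abs_re_le_norm _).trans (norm_inner_le_norm _ _))
    have h2 := Finset.sum_mul_sq_le_sq_mul_sq (Finset.range n) (fun i => ‖y i‖)
      (fun i => ‖B (y (i + 1))‖)
    have h3 : ∑ i ∈ Finset.range n, ‖y i‖ ^ 2 ≤ Y := by
      rw [hY, Finset.sum_range_succ]; nlinarith [sq_nonneg ‖y n‖]
    calc ρ ^ 2 = |ρ| ^ 2 := (sq_abs _).symm
      _ ≤ (∑ i ∈ Finset.range n, ‖y i‖ * ‖B (y (i + 1))‖) ^ 2 := by gcongr
      _ ≤ _ := h2.trans (mul_le_mul_of_nonneg_right h3 ht0)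
  have key : (1 + b) * ρ ≤ b * Y + t := by
    rcases le_or_gt ρ 0 with h | h
    · nlinarith [mul_nonneg hb0 hY0, mul_nonneg hb0 (neg_nonneg.2 h)]
    · have hYpos : 0 < Y := by
        rcases hY0.eq_or_lt with h' | h'
        · rw [← h'] at hρ2; nlinarith
        · exact h'
      -- After multiplication by Y and replacement of Yt by ρ², the claim factors as this product.
      have : 0 ≤ (b * Y - ρ) * (Y - ρ) := mul_nonneg (by linarith) (by nlinarith)
      have h5 : Y * ((1 + b) * ρ) ≤ Y * (b * Y + t) := by nlinarith
      exact le_of_mul_le_mul_left h5 hYpos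
  rw [hL, hx, div_mul_eq_mul_div, le_div_iff₀ (by linarith)]
  linarith

lemma norm_sq_sum_le_card_mul {K : Type*} [SeminormedAddCommGroup K] {ι : Type*} (s : Finset ι)
    (z : ι → K) :
    ‖∑ i ∈ s, z i‖ ^ 2 ≤ s.card * ∑ i ∈ s, ‖z i‖ ^ 2 :=
  calc ‖∑ i ∈ s, z i‖ ^ 2 ≤ (∑ i ∈ s, ‖z i‖) ^ 2 := by gcongr; exact norm_sum_le _ _
    _ ≤ _ := sq_sum_le_card_mul_sum_sq

lemma sum_range_mul_eq {M : Type*} [AddCommMonoid M] (k L : ℕ) (F : ℕ → M) :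
    ∑ i ∈ Finset.range (k * L), F i
      = ∑ r ∈ Finset.range k, ∑ l ∈ Finset.range L, F (r + k * l) := by
  rw [Finset.sum_comm]
  induction L with
  | zero => simp
  | succ L ih =>
    rw [mul_add_one, Finset.sum_range_add, ih, Finset.sum_range_succ]
    simp_rw [add_comm]

/-- Splitting into residue classes modulo `k`. -/
lemma norm_sq_sum_le_of_pow {V : ℕ → H →ₗᵢ[ℂ] K} {P : H →L[ℂ] H}
    (hV : ∀ i j, i ≤ j → ∀ x y, inner ℂ (V i x) (V j y) = inner ℂ x ((P ^ (j - i)) y))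
    {k : ℕ} (hk : 0 < k) {b : ℝ} (hb0 : 0 ≤ b) (hb1 : b < 1)
    (hB : ∀ x, ‖inner ℂ x ((P ^ k) x)‖ ≤ b * ‖x‖ ^ 2) (x : ℕ → H) (n : ℕ) :
    ‖∑ i ∈ Finset.range n, V i (x i)‖ ^ 2
      ≤ k * ((1 + b) / (1 - b)) * ∑ i ∈ Finset.range n, ‖x i‖ ^ 2 := by
  -- Padding with zeros to length k * n gives every residue class modulo k exactly n terms.
  let z : ℕ → H := fun i => if i < n then x i else 0
  have hn : n ≤ k * n := Nat.le_mul_of_pos_left n hk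
  have extR : ∑ i ∈ Finset.range n, ‖x i‖ ^ 2 = ∑ i ∈ Finset.range (k * n), ‖z i‖ ^ 2 := by
    rw [← Finset.sum_subset (Finset.range_mono hn)]
    · exact Finset.sum_congr rfl fun i hi => by simp [z, Finset.mem_range.1 hi]
    · intro i _ hi
      simp only [Finset.mem_range] at hi
      simp [z, hi]
  have extK : ∑ i ∈ Finset.range n, V i (x i) = ∑ i ∈ Finset.range (k * n), V i (z i) := by
    rw [← Finset.sum_subset (Finset.range_mono hn)]
    · exact Finset.sum_congr rfl fun i hi => by simp [z, Finset.mem_range.1 hi]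
    · intro i _ hi
      simp only [Finset.mem_range] at hi
      simp [z, hi]
  rw [extK, extR, sum_range_mul_eq, sum_range_mul_eq]
  calc _ ≤ (k : ℝ) * ∑ r ∈ Finset.range k, ‖∑ l ∈ Finset.range n, V (r + k * l) (z (r + k * l))‖ ^ 2 := by
        simpa using norm_sq_sum_le_card_mul (Finset.range k)
          fun r => ∑ l ∈ Finset.range n, V (r + k * l) (z (r + k * l))
    _ ≤ (k : ℝ) * ∑ r ∈ Finset.range k,
          (1 + b) / (1 - b) * ∑ l ∈ Finset.range n, ‖z (r + k * l)‖ ^ 2 := by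
        gcongr with r _
        refine norm_sq_sum_le (V := fun l => V (r + k * l)) (B := P ^ k) ?_ hb0 hb1 hB _ _
        intro i j hij u v
        rw [hV _ _ (by gcongr), ← pow_mul]
        congr 3
        rw [Nat.mul_sub]; omega
    _ = _ := by rw [← Finset.mul_sum]; ring

end Hilbert

/-! ### The Poisson equation and the asymptotic variance -/

section Poisson

variable {H : Type*} [NormedAddCommGroup H] [InnerProductSpace ℂ H]

/-- The operator norm is at most twice the numerical radius. -/
lemma norm_apply_le_two_mul (T : H →L[ℂ] H) {b : ℝ}
    (hT : ∀ x, ‖inner ℂ x (T x)‖ ≤ b * ‖x‖ ^ 2) (x : H) : ‖T x‖ ≤ 2 * b * ‖x‖ := by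
  rcases eq_or_ne (T x) 0 with h0 | h0
  · rcases eq_or_ne x 0 with rfl | hx
    · simp
    · have : 0 ≤ b := by
        have := (norm_nonneg _).trans (hT x)
        exact nonneg_of_mul_nonneg_left this (by positivity)
      rw [h0, norm_zero]; positivity
  have hx : x ≠ 0 := by rintro rfl; simp at h0
  have hT' : ∀ z, ‖inner ℂ (T z) z‖ ≤ b * ‖z‖ ^ 2 := fun z => by
    rw [norm_inner_symm]; exact hT z
  -- Polarization writes 4⟨T x, y⟩ with four diagonal terms, and the parallelogram law bounds their
  -- total by 8 b ‖x‖². The choice of y is T x rescaled to norm ‖x‖.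
  have key : ∀ y : H, ‖y‖ = ‖x‖ → ‖inner ℂ (T x) y‖ ≤ 2 * b * ‖x‖ ^ 2 := by
    intro y hy
    have h := inner_map_polarization (T : H →ₗ[ℂ] H) y x
    have h1 := parallelogram_law_with_norm ℂ y x
    have h2 := parallelogram_law_with_norm ℂ y (Complex.I • x)
    have h3 : ‖Complex.I • x‖ = ‖x‖ := by simp [norm_smul]
    rw [h3] at h2
    have h4 : (4 : ℝ) * ‖inner ℂ (T x) y‖ ≤ b * ‖y + x‖ ^ 2 + b * ‖y - x‖ ^ 2
        + b * ‖y + Complex.I • x‖ ^ 2 + b * ‖y - Complex.I • x‖ ^ 2 := by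
      have e : (4 : ℝ) * ‖inner ℂ (T x) y‖ = ‖4 * inner ℂ (T x) y‖ := by simp
      have e2 := congrArg (fun w => 4 * w) h
      simp only [ContinuousLinearMap.coe_coe] at e2
      rw [mul_div_cancel₀ _ (by norm_num : (4 : ℂ) ≠ 0)] at e2
      rw [e, e2]
      refine (norm_sub_le _ _).trans (add_le_add ((norm_add_le _ _).trans
        (add_le_add ((norm_sub_le _ _).trans (add_le_add (hT' _) (hT' _))) ?_)) ?_) <;>
      · rw [norm_mul, Complex.norm_I, one_mul]; exact hT' _
    rw [hy] at h1 h2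
    have h6 := congrArg (b * ·) h1
    have h7 := congrArg (b * ·) h2
    linarith
  have h5 := key (((‖x‖ / ‖T x‖ : ℝ) : ℂ) • T x) (by
    rw [norm_smul, Complex.norm_real, Real.norm_of_nonneg (by positivity)]
    field_simp)
  rw [inner_smul_right, norm_mul, Complex.norm_real, Real.norm_of_nonneg (by positivity),
    inner_self_eq_norm_sq_to_K, norm_pow] at h5
  simp only [Complex.coe_algebraMap, Complex.norm_real, norm_norm] at h5
  have hx' := norm_pos_iff.2 hx
  have h6 : ‖x‖ * ‖T x‖ ≤ ‖x‖ * (2 * b * ‖x‖) := by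
    calc ‖x‖ * ‖T x‖ = ‖x‖ / ‖T x‖ * ‖T x‖ ^ 2 := by
          have := norm_pos_iff.2 h0
          field_simp
      _ ≤ _ := h5.trans (le_of_eq (by ring))
  exact le_of_mul_le_mul_left h6 hx'

/-- The Poisson equation is solved by the Neumann series. -/
lemma exists_sub_eq_of_summable [CompleteSpace H] (P : H →L[ℂ] H) {u : ℕ → ℝ} {U : ℝ}
    (hu : HasSum u U) (hP : ∀ j x, ‖(P ^ j) x‖ ≤ u j * ‖x‖) (x : H) :
    ∃ g, g - P g = x ∧ ‖g‖ ≤ U * ‖x‖ := by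
  have hs : Summable fun j => (P ^ j) x :=
    Summable.of_norm_bounded (hu.summable.mul_right ‖x‖) fun j => hP j x
  refine ⟨∑' j, (P ^ j) x, ?_, ?_⟩
  · have h1 : P (∑' j, (P ^ j) x) = ∑' j, (P ^ (j + 1)) x := by
      rw [P.map_tsum hs]
      simp_rw [pow_succ']; rfl
    rw [h1, hs.tsum_eq_zero_add]
    simp
  · exact tsum_of_norm_bounded (hu.mul_right ‖x‖) fun j => hP j x

lemma sub_pow_apply_eq_sum (P : H →L[ℂ] H) {g x : H} (hg : g - P g = x) (n : ℕ) :
    ∑ j ∈ Finset.range n, (P ^ j) x = g - (P ^ n) g := by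
  induction n with
  | zero => simp
  | succ n ih =>
    rw [Finset.sum_range_succ, ih, ← hg, map_sub, pow_succ, mul_apply_eq_comp]
    abel

/-- Since g - P^k g = ∑_{j<k} P^j x has norm at most k‖x‖, pairing it with g gives (1 - b)‖g‖² ≤
k‖g‖‖x‖. This avoids the factor 2 between norm and numerical radius, and is used when b is not
small. -/
lemma norm_le_of_numericalRadius_pow (P : H →L[ℂ] H) (hP : ∀ j x, ‖(P ^ j) x‖ ≤ ‖x‖) {k : ℕ} {b : ℝ}
    (hb : b < 1) (hB : ∀ x, ‖inner ℂ x ((P ^ k) x)‖ ≤ b * ‖x‖ ^ 2) {g x : H} (hg : g - P g = x) :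
    ‖g‖ ≤ k / (1 - b) * ‖x‖ := by
  have h1 := sub_pow_apply_eq_sum P hg k
  have h2 : ‖g - (P ^ k) g‖ ≤ k * ‖x‖ := by
    rw [← h1]
    refine (norm_sum_le _ _).trans ((Finset.sum_le_sum fun j _ => hP j x).trans ?_)
    simp
  have h3 : (1 - b) * ‖g‖ ^ 2 ≤ ‖g‖ * (k * ‖x‖) := by
    have h4 : (inner ℂ g (g - (P ^ k) g)).re = ‖g‖ ^ 2 - (inner ℂ g ((P ^ k) g)).re := by
      rw [inner_sub_right, Complex.sub_re]
      congr 1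
      exact inner_self_eq_norm_sq (𝕜 := ℂ) g
    have h5 := (Complex.re_le_norm _).trans (hB g)
    have h6 := (Complex.re_le_norm _).trans (norm_inner_le_norm (𝕜 := ℂ) g (g - (P ^ k) g))
    have h7 := mul_le_mul_of_nonneg_left h2 (norm_nonneg g)
    linarith
  rw [div_mul_eq_mul_div, le_div_iff₀ (by linarith)]
  rcases (norm_nonneg g).eq_or_lt with h | h
  · rw [← h]; simp only [zero_mul]; positivity
  · exact le_of_mul_le_mul_left (by nlinarith : ‖g‖ * (‖g‖ * (1 - b)) ≤ ‖g‖ * (k * ‖x‖)) h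

variable {K : Type*} [NormedAddCommGroup K] [InnerProductSpace ℂ K]

/-- The second moment of an additive functional in terms of iterated solutions of the Poisson
equation. -/
lemma norm_sq_sum_eq_poisson {V : ℕ → H →ₗᵢ[ℂ] K} {P : H →L[ℂ] H}
    (hV : ∀ i j, i ≤ j → ∀ x y, inner ℂ (V i x) (V j y) = inner ℂ x ((P ^ (j - i)) y))
    {h g x : H} (hg : g - P g = x) (hh : h - P h = g) (n : ℕ) :
    ‖∑ i ∈ Finset.range n, V i x‖ ^ 2
      = n * (‖g‖ ^ 2 - ‖P g‖ ^ 2) - 2 * (inner ℂ x (P h - (P ^ (n + 1)) h)).re := by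
  induction n with
  | zero => simp
  | succ n ih =>
    rw [Finset.sum_range_succ, @norm_add_sq ℂ, ih, (V n).norm_map]
    have h1 : inner ℂ (∑ i ∈ Finset.range n, V i x) (V n x) = inner ℂ x (P g - (P ^ (n + 1)) g) := by
      have e : P g - (P ^ (n + 1)) g = ∑ j ∈ Finset.range n, (P ^ (j + 1)) x := by
        have h2 := sub_pow_apply_eq_sum P hg (n + 1)
        rw [Finset.sum_range_succ'] at h2
        simp only [pow_zero, one_apply_eq_self] at h2
        rw [eq_sub_of_add_eq h2, ← hg]; abel
      rw [e, sum_inner, inner_sum, ← Finset.sum_range_reflect]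
      refine Finset.sum_congr rfl fun i hi => ?_
      rw [Finset.mem_range] at hi
      rw [hV _ _ (by omega)]
      congr 3; omega
    have h3 : (P ^ (n + 1)) g = (P ^ (n + 1)) h - (P ^ (n + 1 + 1)) h := by
      rw [← hh, map_sub, pow_succ _ (n + 1), mul_apply_eq_comp]
    -- Expanding ‖x + P g‖² = ‖g‖² identifies the drift per step; the inner products with h
    -- telescope.
    have h4 : ‖x‖ ^ 2 + 2 * (inner ℂ x (P g)).re = ‖g‖ ^ 2 - ‖P g‖ ^ 2 := by
      have e1 : ‖x + P g‖ ^ 2 = ‖g‖ ^ 2 := by rw [← hg]; simp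
      rw [@norm_add_sq ℂ] at e1
      have e2 : RCLike.re (inner ℂ x (P g)) = (inner ℂ x (P g)).re := rfl
      rw [e2] at e1
      linarith
    have e3 : ∀ w : ℂ, RCLike.re w = w.re := fun _ => rfl
    rw [e3, h1, h3]
    simp only [inner_sub_right, Complex.sub_re]
    push_cast
    linarith

/-- Each of the k terms β^(j+1), j < k, of β(1 + β + … + β^(k-1)) is at least β^k. -/
lemma geom_weight_le {β : ℝ} (h0 : 0 ≤ β) (h1 : β < 1) (k : ℕ) :
    k * β ^ k * (1 - β) ≤ β * (1 - β ^ k) := by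
  have h2 : (∑ j ∈ Finset.range k, β ^ j) * (1 - β) = 1 - β ^ k := by
    have := geom_sum_mul β k; linarith
  have h3 : (k : ℝ) * β ^ k ≤ β * ∑ j ∈ Finset.range k, β ^ j := by
    rw [Finset.mul_sum]
    calc (k : ℝ) * β ^ k = ∑ _j ∈ Finset.range k, β ^ k := by simp
      _ ≤ _ := by
        refine Finset.sum_le_sum fun j hj => ?_
        rw [← pow_succ']
        exact pow_le_pow_of_le_one h0 h1.le (Finset.mem_range.1 hj)
  rw [← h2, ← mul_assoc]
  exact mul_le_mul_of_nonneg_right h3 (by linarith)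

/-- The left side is k + 2kβ^k/(1 - β^k), and `geom_weight_le` bounds kβ^k/(1 - β^k) by its value
β/(1 - β) at k = 1. -/
lemma card_mul_ratio_le {β : ℝ} (h0 : 0 ≤ β) (h1 : β < 1) {k : ℕ} (hk : 0 < k) :
    k * ((1 + β ^ k) / (1 - β ^ k)) ≤ (k - 1) + 2 / (1 - β) := by
  have hb : β ^ k < 1 := pow_lt_one₀ h0 h1 hk.ne'
  have h := geom_weight_le h0 h1 k
  have h2 : k * β ^ k / (1 - β ^ k) ≤ β / (1 - β) := by
    rw [div_le_div_iff₀ (by linarith) (by linarith)]; exact h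
  have e1 : k * ((1 + β ^ k) / (1 - β ^ k)) = k + 2 * (k * β ^ k / (1 - β ^ k)) := by
    have : 1 - β ^ k ≠ 0 := by linarith
    field_simp; ring
  have e2 : 2 / (1 - β) = 1 + (1 + β) / (1 - β) := by
    have : 1 - β ≠ 0 := by linarith
    field_simp; ring
  have e3 : (1 + β) / (1 - β) = (1 - β) / (1 - β) + 2 * (β / (1 - β)) := by ring
  rw [e1, e2, e3, div_self (by linarith)]
  linarith

/-- After k is split off, at most β/(1 - β) remains. Bernoulli, β^e ≥ 1 - e(1 - β), gives β ≤ e(1 -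
β) + β^e, and the assumption 1 ≤ 4β^k turns β^e into at most 4β^(k+e). -/
lemma ratio_le_of_one_le {β : ℝ} (h0 : 0 ≤ β) (h1 : β < 1) {k : ℕ} (hk : 0 < k) (e : ℕ)
    (h4 : 1 ≤ 4 * β ^ k) : k / (1 - β ^ k) ≤ k + e + 4 * β ^ (k + e) / (1 - β) := by
  have hb : β ^ k < 1 := pow_lt_one₀ h0 h1 hk.ne'
  have h := geom_weight_le h0 h1 k
  have h2 : k * β ^ k / (1 - β ^ k) ≤ β / (1 - β) := by
    rw [div_le_div_iff₀ (by linarith) (by linarith)]; exact h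
  have e1 : k / (1 - β ^ k) = k + k * β ^ k / (1 - β ^ k) := by
    have : 1 - β ^ k ≠ 0 := by linarith
    field_simp; ring
  have hB : 1 + e * (β - 1) ≤ β ^ e := by
    have := one_add_mul_le_pow (a := β - 1) (by linarith) e
    simpa using this
  have h3 : β / (1 - β) ≤ e + 4 * β ^ (k + e) / (1 - β) := by
    rw [div_le_iff₀ (by linarith), add_mul, div_mul_cancel₀ _ (by linarith), pow_add]
    nlinarith [mul_le_mul_of_nonneg_right h4 (pow_nonneg h0 e)]
  rw [e1]; linarith

/-- The counterpart of `ratio_le_of_one_le` for small β^k. By Bernoulli, half of 4β^(k+e) covers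
2β^k up to an error 2eβ^k(1 - β), and 4β^k ≤ 1 lets e(1 - β) absorb this error and the term e·2β^k(1
- β). -/
lemma series_le_of_le_one {β : ℝ} (h0 : 0 ≤ β) (h1 : β < 1) (k e : ℕ)
    (h4 : 4 * β ^ k ≤ 1) :
    k + 2 * β ^ k / (1 - β) + e * (2 * β ^ k) ≤ k + e + 4 * β ^ (k + e) / (1 - β) := by
  have hB : 1 + e * (β - 1) ≤ β ^ e := by
    have := one_add_mul_le_pow (a := β - 1) (by linarith) e
    simpa using this
  have hb0 : 0 ≤ β ^ k := pow_nonneg h0 k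
  have h3 : 2 * β ^ k / (1 - β) + e * (2 * β ^ k) ≤ e + 4 * β ^ (k + e) / (1 - β) := by
    rw [← sub_nonneg]
    have e1 : e + 4 * β ^ (k + e) / (1 - β) - (2 * β ^ k / (1 - β) + e * (2 * β ^ k))
        = (e * (1 - 2 * β ^ k) * (1 - β) + 4 * β ^ k * β ^ e - 2 * β ^ k) / (1 - β) := by
      have : 1 - β ≠ 0 := by linarith
      rw [pow_add]; field_simp; ring
    rw [e1]
    refine div_nonneg ?_ (by linarith)
    have h5 : β ^ k * (1 + e * (β - 1)) ≤ β ^ k * β ^ e := mul_le_mul_of_nonneg_left hB hb0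
    have h6 : 0 ≤ (e : ℝ) * (1 - β) * (1 - 4 * β ^ k) :=
      mul_nonneg (mul_nonneg e.cast_nonneg (by linarith)) (by linarith)
    have h7 : 0 ≤ β ^ k * β ^ e := mul_nonneg hb0 (pow_nonneg h0 e)
    nlinarith
  linarith

/-- A bound for `(1 - P)⁻¹` when `P ^ j` has numerical radius at most `β ^ j` for all `j ≥ 1` outside
a finite set. -/
lemma exists_sub_eq_of_numericalRadius [CompleteSpace H] (P : H →L[ℂ] H)
    (hP : ∀ j x, ‖(P ^ j) x‖ ≤ ‖x‖) {β : ℝ} (h0 : 0 ≤ β) (h1 : β < 1) (F : Finset ℕ)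
    (hF0 : 0 ∉ F)
    (hF : ∀ j, 0 < j → j ∉ F → ∀ x, ‖inner ℂ x ((P ^ j) x)‖ ≤ β ^ j * ‖x‖ ^ 2) (x : H) :
    ∃ g, g - P g = x ∧ ‖g‖ ≤ (1 + F.card + 4 * β ^ (F.card + 1) / (1 - β)) * ‖x‖ := by
  classical
  obtain ⟨k, ⟨hk0, hkF⟩, hmin⟩ : ∃ k, (0 < k ∧ k ∉ F) ∧ ∀ j, 0 < j ∧ j ∉ F → k ≤ j := by
    have hex : ∃ k, 0 < k ∧ k ∉ F := by
      obtain ⟨k, hk⟩ := Infinite.exists_notMem_finset (insert 0 F)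
      rw [Finset.mem_insert, not_or] at hk
      exact ⟨k, Nat.pos_of_ne_zero hk.1, hk.2⟩
    exact ⟨Nat.find hex, Nat.find_spec hex, fun j hj => Nat.find_min' hex hj⟩
  set b := β ^ k with hb
  have hb1 : b < 1 := pow_lt_one₀ h0 h1 hk0.ne'
  have hb0 : 0 ≤ b := pow_nonneg h0 k
  set G := F.filter (k ≤ ·) with hG
  -- By minimality of k the exceptional times are exactly 1, …, k - 1 and those in G.
  have hcard : F.card + 1 = k + G.card := by
    have h2 : F.filter (¬ k ≤ ·) = Finset.Ioo 0 k := by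
      ext j
      simp only [Finset.mem_filter, Finset.mem_Ioo, not_le]
      constructor
      · rintro ⟨h, h'⟩
        exact ⟨Nat.pos_of_ne_zero fun h'' => hF0 (h'' ▸ h), h'⟩
      · rintro ⟨h, h'⟩
        refine ⟨?_, h'⟩
        by_contra hc
        exact absurd (hmin j ⟨h, hc⟩) (by omega)
    have h3 := Finset.card_filter_add_card_filter_not (s := F) (k ≤ ·)
    rw [h2, Nat.card_Ioo, ← hG] at h3
    omega
  have hR : (1 + F.card + 4 * β ^ (F.card + 1) / (1 - β) : ℝ)
      = k + G.card + 4 * β ^ (k + G.card) / (1 - β) := by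
    rw [← hcard]
    have : (F.card : ℝ) + 1 = k + G.card := by exact_mod_cast hcard
    linarith
  rw [hR]
  -- Majorant of the Neumann series: contractivity below k, norm at most 2β^j at regular times from
  -- k on, and 2β^k at the exceptional times in G, where P^j = P^(j-k) P^k. The terms may overlap on
  -- G, which only enlarges the bound.
  let u : ℕ → ℝ := fun j => (if j ∈ Finset.range k then 1 else 0)
    + (if k ≤ j then 2 * β ^ j else 0) + (if j ∈ G then 2 * b else 0)
  have hu : HasSum u (k + 2 * b / (1 - β) + G.card * (2 * b)) := by
    refine HasSum.add (HasSum.add ?_ ?_) ?_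
    · have := hasSum_sum_of_ne_finset_zero (L := .unconditional ℕ) (f := fun j => if j ∈ Finset.range k then (1 : ℝ) else 0)
        (s := Finset.range k) (fun j hj => if_neg hj)
      convert! this using 1
      rw [Finset.sum_ite_mem, Finset.inter_self]
      simp
    · rw [← hasSum_nat_add_iff' k]
      have h5 : ∑ i ∈ Finset.range k, (if k ≤ i then 2 * β ^ i else 0) = 0 :=
        Finset.sum_eq_zero fun i hi => if_neg (by rw [Finset.mem_range] at hi; omega)
      rw [h5, sub_zero]
      have h6 := (hasSum_geometric_of_lt_one h0 h1).mul_left (2 * b)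
      rw [← div_eq_mul_inv] at h6
      convert! h6 using 2 with j
      rw [if_pos (by omega), pow_add, hb]; ring
    · have := hasSum_sum_of_ne_finset_zero (L := .unconditional ℕ) (f := fun j => if j ∈ G then 2 * b else 0)
        (s := G) (fun j hj => if_neg hj)
      convert! this using 1
      rw [Finset.sum_ite_mem, Finset.inter_self, Finset.sum_const, nsmul_eq_mul]
  have hPu : ∀ j x, ‖(P ^ j) x‖ ≤ u j * ‖x‖ := by
    intro j x
    rcases lt_or_ge j k with hjk | hjk
    · refine (hP j x).trans ?_
      have : u j = 1 := by
        have hjG : j ∉ G := fun h => by rw [hG, Finset.mem_filter] at h; omega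
        simp only [u, Finset.mem_range, if_pos hjk, if_neg hjG, if_neg (not_le.2 hjk), add_zero]
      rw [this, one_mul]
    · have h8 : 0 ≤ β ^ j := pow_nonneg h0 j
      by_cases hjF : j ∈ F
      · have hjG : j ∈ G := Finset.mem_filter.2 ⟨hjF, hjk⟩
        have h7 : ‖(P ^ j) x‖ ≤ 2 * b * ‖x‖ := by
          rw [← Nat.sub_add_cancel hjk, pow_add, mul_apply_eq_comp]
          exact (hP _ _).trans (norm_apply_le_two_mul _ (hF k hk0 hkF) x)
        refine h7.trans (mul_le_mul_of_nonneg_right ?_ (norm_nonneg _))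
        simp only [u, Finset.mem_range, if_neg (not_lt.2 hjk), if_pos hjG, if_pos hjk]
        linarith
      · refine (norm_apply_le_two_mul _ (hF j (by omega) hjF) x).trans
          (mul_le_mul_of_nonneg_right ?_ (norm_nonneg _))
        have hjG : j ∉ G := fun h => hjF (Finset.mem_filter.1 h).1
        simp only [u, Finset.mem_range, if_neg (not_lt.2 hjk), if_neg hjG, if_pos hjk]
        linarith
  obtain ⟨g, hg, hgn⟩ := exists_sub_eq_of_summable P hu hPu x
  refine ⟨g, hg, ?_⟩
  -- The series always yields g, but its norm bound is good enough only for β^k ≤ 1/4; otherwise g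
  -- is estimated directly from the numerical radius of P^k.
  rcases le_total (4 * b) 1 with h | h
  · exact hgn.trans (mul_le_mul_of_nonneg_right (series_le_of_le_one h0 h1 k _ h) (norm_nonneg _))
  · exact (norm_le_of_numericalRadius_pow P hP hb1 (hF k hk0 hkF) hg).trans
      (mul_le_mul_of_nonneg_right (ratio_le_of_one_le h0 h1 hk0 _ h) (norm_nonneg _))

end Poisson

/-! ### Quadratic forms and spectral bounds of self-adjoint operators -/

section Spectral

variable {H : Type*} [NormedAddCommGroup H] [InnerProductSpace ℂ H] [CompleteSpace H]

/-- The factor ‖1‖ stays because H may be trivial, in which case it is 0. -/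
lemma bounded_real_spectrum (A : H →L[ℂ] H) (a : ℝ) (ha : (a : ℂ) ∈ spectrum ℂ A) :
    |a| ≤ ‖A‖ * ‖(1 : H →L[ℂ] H)‖ := by
  have := spectrum.norm_le_norm_mul_of_mem ha
  rwa [Complex.norm_real, Real.norm_eq_abs] at this

/-- A self-adjoint operator is dominated, in the Loewner order, by any scalar that bounds its
spectrum from above. -/
lemma IsSelfAdjoint.re_inner_le_sSup {A : H →L[ℂ] H} (hA : IsSelfAdjoint A) (x : H) :
    (inner ℂ x (A x)).re ≤ sSup {a : ℝ | (a : ℂ) ∈ spectrum ℂ A} * ‖x‖ ^ 2 := by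
  have hb : BddAbove {a : ℝ | (a : ℂ) ∈ spectrum ℂ A} :=
    ⟨_, fun a ha => (le_abs_self a).trans (bounded_real_spectrum A a ha)⟩
  have h : A ≤ algebraMap ℝ (H →L[ℂ] H) (sSup {a : ℝ | (a : ℂ) ∈ spectrum ℂ A}) := by
    refine le_algebraMap_of_spectrum_le (fun a ha => le_csSup hb ?_)
    exact spectrum.algebraMap_mem ℂ ha
  have h1 := (ContinuousLinearMap.le_def _ _).1 h
  have h2 := h1.re_inner_nonneg_right x
  rw [sub_apply, inner_sub_right, map_sub, Algebra.algebraMap_eq_smul_one,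
    smul_apply, one_apply_eq_self, ← Complex.coe_smul, inner_smul_right,
    inner_self_eq_norm_sq_to_K] at h2
  have h3 : RCLike.re (inner ℂ x (A x)) = (inner ℂ x (A x)).re := rfl
  rw [h3, sub_nonneg] at h2
  refine h2.trans (le_of_eq ?_)
  simp [← Complex.ofReal_pow]

lemma IsSelfAdjoint.sInf_le_re_inner {A : H →L[ℂ] H} (hA : IsSelfAdjoint A) (x : H) :
    sInf {a : ℝ | (a : ℂ) ∈ spectrum ℂ A} * ‖x‖ ^ 2 ≤ (inner ℂ x (A x)).re := by
  have h := IsSelfAdjoint.re_inner_le_sSup hA.neg x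
  have e : {a : ℝ | (a : ℂ) ∈ spectrum ℂ (-A)} = -{a : ℝ | (a : ℂ) ∈ spectrum ℂ A} := by
    ext a
    simp [← spectrum.neg_eq]
  rw [e, Real.sSup_neg] at h
  simp only [neg_apply, inner_neg_right, Complex.neg_re] at h
  linarith

end Spectral

/-! ### The mean-zero subspace as an orthogonal complement -/

section L2zero

variable {E : Type*} [MeasurableSpace E] {μ : Measure E} {T : Target μ}

/-- The constant function one in `L²(π)`. -/
noncomputable def oneL2 (T : Target μ) : Lp ℂ 2 T.law :=
  indicatorConstLp 2 MeasurableSet.univ (measure_ne_top T.law _) 1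

lemma inner_oneL2 (f : Lp ℂ 2 T.law) : inner ℂ (oneL2 T) f = ∫ x, f x ∂T.law := by
  rw [oneL2, L2.inner_indicatorConstLp_one, setIntegral_univ]

lemma mem_L2zero_iff {f : Lp ℂ 2 T.law} : f ∈ L2zero T ↔ inner ℂ (oneL2 T) f = 0 := by
  rw [inner_oneL2]; rfl

instance completeSpace_L2zero : CompleteSpace (L2zero T) := by
  have h : IsClosed (L2zero T : Set (Lp ℂ 2 T.law)) := by
    have : (L2zero T : Set (Lp ℂ 2 T.law)) = {f | inner ℂ (oneL2 T) f = 0} := by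
      ext f; exact mem_L2zero_iff
    rw [this]
    exact isClosed_eq (by fun_prop) continuous_const
  exact h.completeSpace_coe

end L2zero

/-! ### The sesquilinear form and self-adjointness of a reversible signed kernel -/

namespace RevKernel

variable {E : Type*} [MeasurableSpace E] {μ : Measure E} {T : Target μ} (K : RevKernel T)

lemma measurable_dens_mul_k : Measurable (fun z : E × E => T.dens z.1 * K.k z.1 z.2) :=
  (T.measurable_dens.comp measurable_fst).mul K.measurable_k

/-- Since |g(x)f(y)| ≤ |g(x)|² + |f(y)|², the first term is controlled by the row bound and the
second by the weighted Schur test. -/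
lemma integrable_form {f g : E → ℂ} (hf : Measurable f) (hg : Measurable g)
    (hf2 : MemLp f 2 T.law) (hg2 : MemLp g 2 T.law) :
    Integrable (fun z : E × E => (T.dens z.1 * K.k z.1 z.2) • (conj (g z.1) * f z.2))
      (μ.prod μ) := by
  have := T.sFinite
  have hm : Measurable (fun z : E × E => (T.dens z.1 * K.k z.1 z.2) • (conj (g z.1) * f z.2)) :=
    K.measurable_dens_mul_k.smul
      ((Complex.continuous_conj.measurable.comp (hg.comp measurable_fst)).mul (hf.comp measurable_snd))
  have hfin : ∀ {h : E → ℂ}, MemLp h 2 T.law → ∫⁻ x, ‖h x‖ₑ ^ 2 ∂T.law < ∞ := by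
    intro h hh
    have := lintegral_rpow_enorm_lt_top_of_eLpNorm_lt_top two_ne_zero ENNReal.ofNat_ne_top hh.2
    simpa using this
  refine ⟨hm.aestronglyMeasurable, ?_⟩
  have hle : ∀ x y, ‖(T.dens x * K.k x y) • (conj (g x) * f y)‖ₑ
      ≤ (T.dens x : ℝ≥0∞) * (K.k x y * ‖g x‖ₑ ^ 2 + K.k x y * ‖f y‖ₑ ^ 2) := by
    intro x y
    have e1 : ∀ (c : ℝ≥0) (w : ℂ), ‖c • w‖ₑ = c * ‖w‖ₑ := by
      intro c w
      have h : c • w = ((c : ℝ) : ℂ) * w := rfl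
      rw [h, enorm_mul]
      congr 1
      rw [← ofReal_norm, Complex.norm_real, Real.norm_of_nonneg c.coe_nonneg,
        ENNReal.ofReal_coe_nnreal]
    have e2 : ‖conj (g x)‖ₑ = ‖g x‖ₑ := by
      rw [← ofReal_norm, RCLike.norm_conj, ofReal_norm]
    rw [e1, enorm_mul, e2, ENNReal.coe_mul, ← mul_add, mul_assoc]
    gcongr
    rcases le_total ‖g x‖ₑ ‖f y‖ₑ with h | h
    · calc ‖g x‖ₑ * ‖f y‖ₑ ≤ ‖f y‖ₑ * ‖f y‖ₑ := by gcongr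
        _ ≤ _ := by rw [sq, sq]; exact le_add_self
    · calc ‖g x‖ₑ * ‖f y‖ₑ ≤ ‖g x‖ₑ * ‖g x‖ₑ := by gcongr
        _ ≤ _ := by rw [sq, sq]; exact le_self_add
  have hkx : ∀ x, Measurable (fun y => (K.k x y : ℝ≥0∞)) := fun x =>
    K.measurable_k_coe.comp measurable_prodMk_left
  have hG := hg.enorm.pow_const 2
  have hF := hf.enorm.pow_const 2
  have hkF : Measurable fun x => ∫⁻ y, K.k x y * ‖f y‖ₑ ^ 2 ∂μ :=
    Measurable.lintegral_prod_right (K.measurable_k_coe.mul (hF.comp measurable_snd))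
  rw [HasFiniteIntegral, lintegral_prod _ hm.enorm.aemeasurable]
  calc _ ≤ ∫⁻ x, ∫⁻ y, (T.dens x : ℝ≥0∞) * (K.k x y * ‖g x‖ₑ ^ 2 + K.k x y * ‖f y‖ₑ ^ 2) ∂μ ∂μ :=
        lintegral_mono fun x => lintegral_mono fun y => hle x y
    _ = ∫⁻ x, (T.dens x : ℝ≥0∞) * ((∫⁻ y, K.k x y ∂μ) * ‖g x‖ₑ ^ 2
          + ∫⁻ y, K.k x y * ‖f y‖ₑ ^ 2 ∂μ) ∂μ := by
        refine lintegral_congr fun x => ?_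
        refine (lintegral_const_mul _ (((hkx x).mul_const _).add ((hkx x).mul hF))).trans ?_
        rw [← lintegral_mul_const _ (hkx x), ← lintegral_add_left ((hkx x).mul_const _)]
        rfl
    _ ≤ ∫⁻ x, (T.dens x : ℝ≥0∞) * (2 * ‖g x‖ₑ ^ 2 + ∫⁻ y, K.k x y * ‖f y‖ₑ ^ 2 ∂μ) ∂μ := by
        refine lintegral_mono_ae ?_
        filter_upwards [K.row_le] with x hx
        gcongr
    _ = 2 * ∫⁻ x, ‖g x‖ₑ ^ 2 ∂T.law + ∫⁻ x, ∫⁻ y, K.k x y * ‖f y‖ₑ ^ 2 ∂μ ∂T.law := by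
        rw [← lintegral_const_mul _ hG, ← lintegral_add_left (hG.const_mul 2)]
        exact (T.lintegral_law ((hG.const_mul 2).add hkF)).symm
    _ < ∞ := by
        refine ENNReal.add_lt_top.2 ⟨ENNReal.mul_lt_top (by norm_num) (hfin hg2), ?_⟩
        exact (K.lintegral_lintegral_le hF).trans_lt (ENNReal.mul_lt_top (by norm_num) (hfin hf2))

lemma integrable_diag (f g : Lp ℂ 2 T.law) :
    Integrable (fun x => (K.r x : ℂ) * (conj (g x) * f x)) T.law := by
  have h := L2.integrable_inner (𝕜 := ℂ) g f
  refine h.mono ?_ (ae_of_all _ fun x => ?_)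
  · exact ((Complex.measurable_ofReal.comp K.measurable_r).mul
      ((Complex.continuous_conj.measurable.comp (measurable_coe g)).mul (measurable_coe f))).aestronglyMeasurable
  · rw [RCLike.inner_apply, norm_mul, Complex.norm_real, Real.norm_eq_abs, mul_comm (f x)]
    exact mul_le_of_le_one_left (norm_nonneg _) (K.abs_r_le x)

/-- The sesquilinear form of the operator `K`. -/
lemma inner_op (f g : Lp ℂ 2 T.law) :
    inner ℂ g (K.op f)
      = ∫ z : E × E, (T.dens z.1 * K.k z.1 z.2) • (conj (g z.1) * f z.2) ∂(μ.prod μ)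
        + ∫ x, (K.r x : ℂ) * (conj (g x) * f x) ∂T.law := by
  have := T.sFinite
  have h1 : (fun x => inner ℂ (g x) (K.op f x)) =ᵐ[T.law]
      fun x => conj (g x) * (∫ y, K.k x y • f y ∂μ) + (K.r x : ℂ) * (conj (g x) * f x) := by
    filter_upwards [K.coeFn_op f] with x hx
    rw [hx, RCLike.inner_apply, act]; ring
  have hint := (L2.integrable_inner (𝕜 := ℂ) g (K.op f)).congr h1
  have hd := K.integrable_diag f g
  have hk : Integrable (fun x => conj (g x) * (∫ y, K.k x y • f y ∂μ)) T.law := by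
    refine (hint.sub hd).congr (ae_of_all _ fun x => ?_)
    simp
  rw [L2.inner_def, integral_congr_ae h1, integral_add hk hd]
  congr 1
  have hprod := K.integrable_form (measurable_coe f) (measurable_coe g) (Lp.memLp f) (Lp.memLp g)
  rw [integral_prod _ hprod]
  refine (integral_withDensity_eq_integral_smul T.measurable_dens _).trans ?_
  refine integral_congr_ae (ae_of_all _ fun x => ?_)
  simp only
  rw [← integral_const_mul]
  refine (integral_const_mul ((T.dens x : ℝ) : ℂ) _).symm.trans ?_
  refine integral_congr_ae (ae_of_all _ fun y => ?_)
  simp only [NNReal.smul_def, Complex.real_smul, NNReal.coe_mul, Complex.ofReal_mul]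
  ring

lemma ae_prod_ne_zero : ∀ᵐ z : E × E ∂(μ.prod μ), T.dens z.1 ≠ 0 ∧ T.dens z.2 ≠ 0 := by
  have := T.sFinite
  exact (Measure.quasiMeasurePreserving_fst.ae T.ae_ne_zero).and
    (Measure.quasiMeasurePreserving_snd.ae T.ae_ne_zero)

/-- Swapping the coordinates and using detailed balance. Balance is available only where both
densities are nonzero, which holds almost everywhere for the product measure. -/
lemma inner_op_symm (f g : Lp ℂ 2 T.law) : inner ℂ (K.op g) f = inner ℂ g (K.op f) := by
  have := T.sFinite
  rw [← inner_conj_symm, inner_op, inner_op, map_add, ← integral_conj, ← integral_conj]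
  congr 1
  · rw [← integral_prod_swap]
    refine integral_congr_ae ?_
    filter_upwards [ae_prod_ne_zero (T := T)] with z hz
    simp only [Prod.fst_swap, Prod.snd_swap]
    rw [K.balance _ _ hz.2 hz.1]
    simp only [NNReal.smul_def, Complex.real_smul, map_mul, Complex.conj_ofReal, Complex.conj_conj]
    ring
  · refine integral_congr_ae (ae_of_all _ fun x => ?_)
    simp only [map_mul, Complex.conj_ofReal, Complex.conj_conj]
    ring

lemma isSelfAdjoint_opZero : IsSelfAdjoint K.opZero := by
  rw [ContinuousLinearMap.isSelfAdjoint_iff_isSymmetric]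
  intro f g
  exact K.inner_op_symm g f

lemma re_inner_op_le_specSup {f : Lp ℂ 2 T.law} (hf : f ∈ L2zero T) :
    (inner ℂ f (K.op f)).re ≤ K.specSup * ‖f‖ ^ 2 :=
  IsSelfAdjoint.re_inner_le_sSup K.isSelfAdjoint_opZero ⟨f, hf⟩

lemma specInf_le_re_inner_op {f : Lp ℂ 2 T.law} (hf : f ∈ L2zero T) :
    K.specInf * ‖f‖ ^ 2 ≤ (inner ℂ f (K.op f)).re :=
  IsSelfAdjoint.sInf_le_re_inner K.isSelfAdjoint_opZero ⟨f, hf⟩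

lemma op_oneL2 : K.op (oneL2 T) = oneL2 T := by
  have h1 : (oneL2 T : E → ℂ) =ᵐ[T.law] fun _ => 1 := by
    refine indicatorConstLp_coeFn.trans (ae_of_all _ fun x => ?_)
    simp
  refine Lp.ext ((K.coeFn_op _).trans ((K.act_congr h1).trans (EventuallyEq.trans ?_ h1.symm)))
  filter_upwards [T.law_ac.ae_le K.total] with x hx
  have e : ∫ y, K.k x y • (1 : ℂ) ∂μ = ((∫⁻ y, K.k x y ∂μ).toReal : ℂ) := by
    have e3 : ∫ y, (K.k x y : ℝ) ∂μ = (∫⁻ y, K.k x y ∂μ).toReal := by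
      rw [integral_eq_lintegral_of_nonneg_ae (ae_of_all _ fun y => (K.k x y).coe_nonneg)
        (K.measurable_k.comp measurable_prodMk_left).coe_nnreal_real.aestronglyMeasurable]
      simp
    rw [← e3]
    refine Eq.trans ?_ integral_ofReal
    refine integral_congr_ae (ae_of_all _ fun y => ?_)
    simp [NNReal.smul_def]
  simp only [act]
  rw [e, mul_one]
  exact_mod_cast hx

end RevKernel

/-! ### The L² operator of a Markov kernel with invariant law -/

section MarkovOp

variable {E : Type*} [MeasurableSpace E]

lemma integral_comp_measure {m : Measure E} [SFinite m] {κ : Kernel E E} [IsSFiniteKernel κ]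
    {f : E → ℂ} (hf : Integrable f (κ ∘ₘ m)) :
    ∫ y, f y ∂(κ ∘ₘ m) = ∫ x, ∫ y, f y ∂(κ x) ∂m := by
  have h1 : Integrable (fun p : E × E => f p.2) (m ⊗ₘ κ) :=
    (Measure.integrable_compProd_snd_iff hf.1).2 hf
  rw [← Measure.integral_compProd h1, ← Measure.snd_compProd, Measure.snd,
    integral_map measurable_snd.aemeasurable]
  have := hf.1
  rwa [← Measure.snd_compProd] at this

/-- The isometry `f ↦ f ∘ X` between `L²` spaces given by a measure preserving map. -/
noncomputable def pullback {Ω F : Type*} [MeasurableSpace Ω] [MeasurableSpace F] {Pr : Measure Ω}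
    {ν : Measure F} {X : Ω → F} (hX : MeasurePreserving X Pr ν) : Lp ℂ 2 ν →ₗᵢ[ℂ] Lp ℂ 2 Pr :=
  Lp.compMeasurePreservingₗᵢ ℂ X hX

section Pullback

variable {Ω F : Type*} [MeasurableSpace Ω] [MeasurableSpace F] {Pr : Measure Ω}
    {ν : Measure F} {X : Ω → F} (hX : MeasurePreserving X Pr ν)

lemma coeFn_pullback (f : Lp ℂ 2 ν) : pullback hX f =ᵐ[Pr] f ∘ X :=
  Lp.coeFn_compMeasurePreserving f hX

lemma inner_pullback_indicator [IsFiniteMeasure Pr] [IsFiniteMeasure ν] {G : Set F}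
    (hG : MeasurableSet G) (w : Lp ℂ 2 Pr) :
    inner ℂ (pullback hX (indicatorConstLp 2 hG (measure_ne_top ν G) 1)) w
      = ∫ ω in X ⁻¹' G, w ω ∂Pr := by
  have : pullback hX (indicatorConstLp 2 hG (measure_ne_top ν G) (1 : ℂ))
      = indicatorConstLp 2 (hX.measurable hG) (measure_ne_top Pr _) 1 :=
    Lp.indicatorConstLp_compMeasurePreserving hG (measure_ne_top ν G) 1 hX
  rw [this, L2.inner_indicatorConstLp_one]

end Pullback

/-- An element of `L²` that is orthogonal to all indicator functions is zero. -/
lemma L2_eq_zero_of_inner_indicator {F : Type*} [MeasurableSpace F] {ν : Measure F}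
    [IsFiniteMeasure ν] {w : Lp ℂ 2 ν}
    (h : ∀ (G : Set F) (hG : MeasurableSet G),
      inner ℂ (indicatorConstLp 2 hG (measure_ne_top ν G) (1 : ℂ)) w = 0) : w = 0 := by
  refine Lp.ext (EventuallyEq.trans ?_ (Lp.coeFn_zero ℂ 2 ν).symm)
  refine Integrable.ae_eq_zero_of_forall_setIntegral_eq_zero
    ((Lp.memLp w).integrable one_le_two) fun G hG _ => ?_
  rw [← L2.inner_indicatorConstLp_one hG (measure_ne_top ν G), h]

variable {ν : Measure E} [IsProbabilityMeasure ν] {κ η : Kernel E E} [IsMarkovKernel κ]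
  [IsMarkovKernel η]

lemma measurePreserving_fst_compProd (ν : Measure E) [IsProbabilityMeasure ν] (κ : Kernel E E)
    [IsMarkovKernel κ] : MeasurePreserving Prod.fst (ν ⊗ₘ κ) ν :=
  ⟨measurable_fst, Measure.fst_compProd ν κ⟩

lemma measurePreserving_snd_compProd (hκ : κ.Invariant ν) :
    MeasurePreserving Prod.snd (ν ⊗ₘ κ) ν :=
  ⟨measurable_snd, (Measure.snd_compProd ν κ).trans hκ⟩

/-- The operator on `L²(ν)` of a Markov kernel with invariant law `ν`. -/
noncomputable def markovOp (hκ : κ.Invariant ν) : Lp ℂ 2 ν →L[ℂ] Lp ℂ 2 ν :=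
  ContinuousLinearMap.adjoint
    (pullback (measurePreserving_fst_compProd ν κ)).toContinuousLinearMap ∘L
    (pullback (measurePreserving_snd_compProd hκ)).toContinuousLinearMap

lemma inner_markovOp (hκ : κ.Invariant ν) (f g : Lp ℂ 2 ν) :
    inner ℂ g (markovOp hκ f) = inner ℂ (pullback (measurePreserving_fst_compProd ν κ) g)
      (pullback (measurePreserving_snd_compProd hκ) f) := by
  rw [markovOp, ContinuousLinearMap.comp_apply, ContinuousLinearMap.adjoint_inner_right]
  rfl

lemma norm_markovOp_le (hκ : κ.Invariant ν) (f : Lp ℂ 2 ν) : ‖markovOp hκ f‖ ≤ ‖f‖ := by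
  have h : ‖markovOp hκ f‖ * ‖markovOp hκ f‖ ≤ ‖markovOp hκ f‖ * ‖f‖ := by
    have h1 := inner_markovOp hκ f (markovOp hκ f)
    have h2 := norm_inner_le_norm (𝕜 := ℂ)
      (pullback (measurePreserving_fst_compProd ν κ) (markovOp hκ f))
      (pullback (measurePreserving_snd_compProd hκ) f)
    rw [← h1, LinearIsometry.norm_map, LinearIsometry.norm_map, inner_self_eq_norm_sq_to_K] at h2
    simpa [sq] using h2
  rcases (norm_nonneg (markovOp hκ f)).eq_or_lt with h0 | h0
  · rw [← h0]; exact norm_nonneg f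
  · exact le_of_mul_le_mul_left h h0

lemma integrable_coe_L2 (f : Lp ℂ 2 ν) : Integrable f ν := (Lp.memLp f).integrable one_le_two

/-- A conditional expectation is determined by its integrals over measurable sets: paired with the
indicator of G, the operator gives the integral of f(y) over G × E under ν ⊗ κ, which disintegrates
into the right side. -/
lemma coeFn_markovOp (hκ : κ.Invariant ν) (f : Lp ℂ 2 ν) :
    markovOp hκ f =ᵐ[ν] fun x => ∫ y, f y ∂(κ x) := by
  have hf : Integrable f (κ ∘ₘ ν) := by
    have : κ ∘ₘ ν = ν := hκ
    rw [this]; exact integrable_coe_L2 f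
  have h1 : Integrable (fun p : E × E => f p.2) (ν ⊗ₘ κ) :=
    (Measure.integrable_compProd_snd_iff hf.1).2 hf
  have h2 : Integrable (fun x => ∫ y, f y ∂(κ x)) ν := by
    rw [Measure.comp_eq_comp_const_apply] at hf
    exact hf.integral_comp
  refine Integrable.ae_eq_of_forall_setIntegral_eq _ _ (integrable_coe_L2 _) h2
    fun G hG _ => ?_
  rw [← L2.inner_indicatorConstLp_one hG (measure_ne_top ν G), inner_markovOp,
    inner_pullback_indicator]
  rw [setIntegral_congr_ae (measurable_fst hG)
    ((coeFn_pullback (measurePreserving_snd_compProd hκ) f).mono fun z hz _ => hz)]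
  have e : (Prod.fst ⁻¹' G : Set (E × E)) = G ×ˢ Set.univ := by ext; simp
  rw [e]
  have := Measure.setIntegral_compProd (s := G) (t := Set.univ) hG MeasurableSet.univ
    h1.integrableOn
  simpa using this

/-- Kernels act on functions contravariantly: κ is the first step of the chain and the last operator
applied. -/
lemma markovOp_comp (hκ : κ.Invariant ν) (hη : η.Invariant ν) (hc : (η ∘ₖ κ).Invariant ν)
    (f : Lp ℂ 2 ν) : markovOp hc f = markovOp hκ (markovOp hη f) := by
  have hκ' : κ ∘ₘ ν = ν := hκ
  have hc' : (η ∘ₖ κ) ∘ₘ ν = ν := hc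
  have hf : Integrable f ((η ∘ₖ κ) ∘ₘ ν) := by rw [hc']; exact integrable_coe_L2 f
  have h2 : ∀ᵐ y ∂(κ ∘ₘ ν), markovOp hη f y = ∫ z, f z ∂(η y) := by
    rw [hκ']; exact coeFn_markovOp hη f
  refine Lp.ext ((coeFn_markovOp hc f).trans (EventuallyEq.symm ?_))
  filter_upwards [coeFn_markovOp hκ (markovOp hη f), Measure.ae_ae_of_ae_comp h2,
    Measure.ae_integrable_of_integrable_comp hf] with x h3 h4 h5
  rw [h3, integral_congr_ae h4, Kernel.integral_comp h5]

end MarkovOp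

/-! ### Powers of the Markov operator on L²₀(π) -/

namespace StationaryKernel

variable {E : Type*} [MeasurableSpace E] {μ : Measure E} {T : Target μ} (S : StationaryKernel T)

attribute [instance] StationaryKernel.isMarkov

/-- The operator on `L²(π)` of a stationary kernel. -/
noncomputable def op : Lp ℂ 2 T.law →L[ℂ] Lp ℂ 2 T.law := markovOp S.invariant

lemma norm_op_le (f : Lp ℂ 2 T.law) : ‖S.op f‖ ≤ ‖f‖ := norm_markovOp_le S.invariant f

lemma op_iter (n : ℕ) : (S.iter n).op = S.op ^ (n + 1) := by
  induction n with
  | zero => simp [iter]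
  | succ n ih =>
    ext1 f
    rw [pow_succ, mul_apply_eq_comp, ← ih]
    exact markovOp_comp (S.iter n).invariant S.invariant ((S.iter n).comp S).invariant f

lemma op_pow (n : ℕ+) : (S.pow n).op = S.op ^ (n : ℕ) := by
  rw [pow, op_iter, PNat.natPred_add_one]

lemma op_mem_L2zero {f : Lp ℂ 2 T.law} (hf : f ∈ L2zero T) : S.op f ∈ L2zero T := by
  rw [mem_L2zero_iff] at hf ⊢
  rw [← hf, oneL2]
  refine (inner_markovOp S.invariant f _).trans ?_
  rw [inner_pullback_indicator, L2.inner_indicatorConstLp_one, Set.preimage_univ,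
    setIntegral_univ, setIntegral_univ, integral_congr_ae (coeFn_pullback _ f)]
  exact (integral_map_of_stronglyMeasurable measurable_snd (Lp.stronglyMeasurable f)).symm.trans
    (by rw [(measurePreserving_snd_compProd S.invariant).map_eq])

/-- The restriction of the operator of a stationary kernel to `L²₀(π)`. -/
noncomputable def opZero : L2zero T →L[ℂ] L2zero T :=
  S.op.restrict fun _ hf => S.op_mem_L2zero hf

lemma coe_opZero_pow (n : ℕ) (f : L2zero T) :
    ((S.opZero ^ n) f : Lp ℂ 2 T.law) = (S.op ^ n) f := by
  induction n with
  | zero => simp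
  | succ n ih => rw [pow_succ', pow_succ', mul_apply_eq_comp, mul_apply_eq_comp, ← ih]; rfl

lemma norm_opZero_pow_le (n : ℕ) (f : L2zero T) : ‖(S.opZero ^ n) f‖ ≤ ‖f‖ := by
  induction n with
  | zero => simp
  | succ n ih =>
    rw [pow_succ', mul_apply_eq_comp]
    exact (S.norm_op_le _).trans ih

end StationaryKernel

/-! ### Atoms and antisymmetric sets -/

section Atoms

variable {E : Type*} [MeasurableSpace E]

/-- If subsets of `A` of positive measure have measure bounded below, then `A` contains an atom. -/
lemma exists_atom_of_le_measure {ν : Measure E} [IsFiniteMeasure ν] {A : Set E}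
    (hA : MeasurableSet A) (hA0 : ν A ≠ 0) {δ : ℝ} (hδ : 0 < δ)
    (h : ∀ B ⊆ A, MeasurableSet B → ν B ≠ 0 → δ ≤ ν.real B) :
    ∃ B ⊆ A, MeasurableSet B ∧ ν B ≠ 0 ∧
      ∀ C, MeasurableSet C → ν.restrict B C = 0 ∨ ν.restrict B Cᶜ = 0 := by
  set s : Set ℝ := {t | ∃ B ⊆ A, MeasurableSet B ∧ ν B ≠ 0 ∧ t = ν.real B} with hs
  have hne : s.Nonempty := ⟨_, A, subset_rfl, hA, hA0, rfl⟩
  have hbd : ∀ t ∈ s, δ ≤ t := by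
    rintro t ⟨B, hB, hBm, hB0, rfl⟩
    exact h B hB hBm hB0
  have hpos : 0 < sInf s := hδ.trans_le (le_csInf hne hbd)
  -- A set with less than twice the infimal measure cannot be cut into two pieces of positive
  -- measure, as each piece would have at least the infimum.
  obtain ⟨t, ⟨B, hB, hBm, hB0, rfl⟩, hlt⟩ := exists_lt_of_csInf_lt hne
    (show sInf s < 2 * sInf s by linarith)
  refine ⟨B, hB, hBm, hB0, fun C hC => ?_⟩
  rw [Measure.restrict_apply hC, Measure.restrict_apply hC.compl]
  by_contra hcon
  rw [not_or] at hcon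
  have hle : ∀ D, MeasurableSet D → ν (D ∩ B) ≠ 0 → sInf s ≤ ν.real (D ∩ B) := fun D hD h0 =>
    csInf_le ⟨δ, hbd⟩ ⟨_, Set.inter_subset_right.trans hB, hD.inter hBm, h0, rfl⟩
  have h1 := hle C hC hcon.1
  have h2 := hle Cᶜ hC.compl hcon.2
  have h3 := measureReal_inter_add_sdiff (μ := ν) (s := B) hC
  have e : B \ C = Cᶜ ∩ B := by ext; simp [and_comm]
  rw [Set.inter_comm, e] at h3
  linarith

/-- For a zero-one measure, sections are null or conull, hence so is D in the product. If D were
conull, so would be its transpose; but the transpose lies in the null set Dᶜ. -/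
lemma prod_eq_zero_of_atom {ν : Measure E} [IsFiniteMeasure ν]
    (hat : ∀ C, MeasurableSet C → ν C = 0 ∨ ν Cᶜ = 0) {D : Set (E × E)} (hD : MeasurableSet D)
    (hdisj : ∀ z ∈ D, z.swap ∉ D) : (ν.prod ν) D = 0 := by
  by_contra hne
  have hm : Measurable fun x => ν (Prod.mk x ⁻¹' D) := measurable_measure_prodMk_left hD
  have hG : MeasurableSet {x | ν (Prod.mk x ⁻¹' D) = 0} := hm (measurableSet_singleton 0)
  have hfull : (ν.prod ν) Dᶜ = 0 := by
    rw [Measure.measure_prod_null hD.compl]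
    rcases hat _ hG with h | h
    · have : ∀ᵐ x ∂ν, ν (Prod.mk x ⁻¹' D) ≠ 0 := by rw [ae_iff]; simpa using h
      filter_upwards [this] with x hx
      exact (hat _ (measurable_prodMk_left hD)).resolve_left hx
    · exfalso
      exact hne ((Measure.measure_prod_null hD).2 h)
  have hswap : (ν.prod ν) (Prod.swap ⁻¹' D) = (ν.prod ν) D :=
    (Measure.measurePreserving_swap (μ := ν) (ν := ν)).measure_preimage hD.nullMeasurableSet
  have hsub : Prod.swap ⁻¹' D ⊆ Dᶜ := fun z hz hzD => hdisj _ hzD hz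
  exact hne (hswap ▸ measure_mono_null hsub hfull)

end Atoms

/-! ### Centered indicators as test functions -/

namespace RevKernel

variable {E : Type*} [MeasurableSpace E] {μ : Measure E} {T : Target μ} (K : RevKernel T)

lemma norm_oneL2 : ‖oneL2 T‖ = 1 := by
  rw [oneL2, norm_indicatorConstLp two_ne_zero ENNReal.ofNat_ne_top]
  simp

/-- K fixes constants and is symmetric, so projecting a test function onto L²₀(π) changes its form
only by the square of its mean. -/
lemma inner_op_centered {e : Lp ℂ 2 T.law} {a : ℝ} (he : inner ℂ (oneL2 T) e = a) :
    inner ℂ (e - (a : ℂ) • oneL2 T) (K.op (e - (a : ℂ) • oneL2 T)) = inner ℂ e (K.op e) - a ^ 2 := by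
  have h1 : inner ℂ e (oneL2 T) = a := by
    rw [← inner_conj_symm, he, Complex.conj_ofReal]
  have h2 : inner ℂ (oneL2 T) (K.op e) = a := by
    rw [← K.inner_op_symm, op_oneL2, he]
  have h3 : inner ℂ (oneL2 T) (oneL2 T) = (1 : ℂ) := by
    rw [inner_self_eq_norm_sq_to_K, norm_oneL2]; simp
  rw [map_sub, map_smul, op_oneL2]
  simp only [inner_sub_left, inner_sub_right, inner_smul_left, inner_smul_right, h1, h2, h3,
    Complex.conj_ofReal]
  ring

lemma inner_oneL2_indicator {B : Set E} (hB : MeasurableSet B) :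
    inner ℂ (oneL2 T) (indicatorConstLp 2 hB (measure_ne_top T.law B) (1 : ℂ))
      = (T.law.real B : ℂ) := by
  rw [inner_oneL2, integral_indicatorConstLp]
  simp

lemma norm_sq_indicator {B : Set E} (hB : MeasurableSet B) :
    ‖indicatorConstLp 2 hB (measure_ne_top T.law B) (1 : ℂ)‖ ^ 2 = T.law.real B := by
  rw [norm_indicatorConstLp two_ne_zero ENNReal.ofNat_ne_top, norm_one, one_mul,
    ← Real.rpow_natCast, ← Real.rpow_mul measureReal_nonneg]
  norm_num

lemma norm_sq_centered {e : Lp ℂ 2 T.law} {a : ℝ} (he : inner ℂ (oneL2 T) e = a) :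
    ‖e - (a : ℂ) • oneL2 T‖ ^ 2 = ‖e‖ ^ 2 - a ^ 2 := by
  rw [@norm_sub_sq ℂ, inner_smul_right, ← inner_conj_symm, he, norm_smul, norm_oneL2,
    Complex.norm_real, Complex.conj_ofReal, ← Complex.ofReal_mul]
  have : RCLike.re ((a * a : ℝ) : ℂ) = a * a := Complex.ofReal_re _
  rw [this, Real.norm_eq_abs, mul_one, sq_abs]
  ring

lemma centered_mem_L2zero {e : Lp ℂ 2 T.law} {a : ℝ} (he : inner ℂ (oneL2 T) e = a) :
    e - (a : ℂ) • oneL2 T ∈ L2zero T := by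
  rw [mem_L2zero_iff, inner_sub_right, inner_smul_right, he, inner_self_eq_norm_sq_to_K, norm_oneL2]
  simp

lemma op_indicator_ae {B : Set E} (hB : MeasurableSet B) :
    ∀ᵐ x ∂(T.law.restrict B), K.op (indicatorConstLp 2 hB (measure_ne_top T.law B) (1 : ℂ)) x
      = ((∫ y in B, (K.k x y : ℝ) ∂μ + K.r x : ℝ) : ℂ) := by
  have h1 : (indicatorConstLp 2 hB (measure_ne_top T.law B) (1 : ℂ) : E → ℂ)
      =ᵐ[T.law] B.indicator fun _ => 1 := indicatorConstLp_coeFn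
  have h2 := (K.coeFn_op _).trans (K.act_congr h1)
  filter_upwards [ae_restrict_of_ae h2, ae_restrict_mem hB] with x hx hxB
  rw [hx, act, Set.indicator_of_mem hxB, mul_one, Complex.ofReal_add]
  congr 1
  rw [← integral_indicator hB]
  refine Eq.trans ?_ integral_ofReal
  refine integral_congr_ae (ae_of_all _ fun y => ?_)
  by_cases hy : y ∈ B <;> simp [hy, NNReal.smul_def]

lemma re_inner_op_indicator {B : Set E} (hB : MeasurableSet B) :
    (inner ℂ (indicatorConstLp 2 hB (measure_ne_top T.law B) (1 : ℂ))
      (K.op (indicatorConstLp 2 hB (measure_ne_top T.law B) 1))).re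
      = ∫ x in B, (∫ y in B, (K.k x y : ℝ) ∂μ + K.r x) ∂T.law := by
  rw [L2.inner_indicatorConstLp_one, integral_congr_ae (K.op_indicator_ae hB)]
  have : ∫ x in B, ((∫ y in B, (K.k x y : ℝ) ∂μ + K.r x : ℝ) : ℂ) ∂T.law
      = ((∫ x in B, (∫ y in B, (K.k x y : ℝ) ∂μ + K.r x) ∂T.law : ℝ) : ℂ) := integral_ofReal
  rw [this, Complex.ofReal_re]

lemma integrable_indicator_form {B : Set E} (hB : MeasurableSet B) :
    IntegrableOn (fun x => ∫ y in B, (K.k x y : ℝ) ∂μ + K.r x) B T.law := by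
  have h := (integrable_coe_L2 (ν := T.law)
    (K.op (indicatorConstLp 2 hB (measure_ne_top T.law B) (1 : ℂ)))).integrableOn (s := B)
  have h2 := (h.congr (K.op_indicator_ae hB)).re
  exact h2

end RevKernel

/-! ### The almost sure bound on the rejection probability -/

namespace StationaryKernel

variable {E : Type*} [MeasurableSpace E] {μ : Measure E} {T : Target μ} (S : StationaryKernel T)

lemma r1_nonneg (x : E) : 0 ≤ S.r1 x := by
  have h : (∫⁻ y, S.m1 x y ∂μ).toReal ≤ 1 := by
    simpa using ENNReal.toReal_mono ENNReal.one_ne_top (S.lintegral_m1_le x)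
  unfold r1; linarith

lemma m1_eq_m2_of_balanced {x y : E} (hx : T.dens x ≠ 0)
    (h : T.dens x * S.p x y = T.dens y * S.p y x) : S.m1 x y = S.m2 x y := by
  refine mul_left_cancel₀ hx ?_
  rw [S.dens_mul_m1, S.dens_mul_m2 hx, h, min_self, max_self]

/-- The sets where the flow from x to y is strictly smaller, or strictly larger, than the reverse
flow are disjoint from their transposes, hence null on an atom squared. Where the two flows agree,
so do their minimum and maximum. -/
lemma ae_m1_eq_m2_of_atom {B : Set E}
    (hat : ∀ C, MeasurableSet C → T.law.restrict B C = 0 ∨ T.law.restrict B Cᶜ = 0) :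
    ∀ᵐ x ∂(T.law.restrict B), ∀ᵐ y ∂(T.law.restrict B), S.m1 x y = S.m2 x y := by
  have hm : Measurable fun z : E × E => T.dens z.1 * S.p z.1 z.2 :=
    (T.measurable_dens.comp measurable_fst).mul S.measurable_p
  have hD : MeasurableSet {z : E × E | T.dens z.1 * S.p z.1 z.2 < T.dens z.2 * S.p z.2 z.1} :=
    measurableSet_lt hm (hm.comp measurable_swap)
  have h1 := prod_eq_zero_of_atom hat hD fun z hz hz' =>
    lt_asymm (show T.dens z.1 * S.p z.1 z.2 < T.dens z.2 * S.p z.2 z.1 from hz) hz'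
  have h2 := prod_eq_zero_of_atom hat (measurable_swap hD) fun z hz hz' =>
    lt_asymm (show T.dens z.2 * S.p z.2 z.1 < T.dens z.1 * S.p z.1 z.2 from hz) hz'
  have h3 : ∀ᵐ z ∂((T.law.restrict B).prod (T.law.restrict B)),
      T.dens z.1 * S.p z.1 z.2 = T.dens z.2 * S.p z.2 z.1 := by
    filter_upwards [measure_eq_zero_iff_ae_notMem.1 h1, measure_eq_zero_iff_ae_notMem.1 h2]
      with z hz1 hz2
    exact le_antisymm (not_lt.1 hz2) (not_lt.1 hz1)
  filter_upwards [Measure.ae_ae_of_ae_prod h3, ae_restrict_of_ae (T.law_ac.ae_le T.ae_ne_zero)]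
    with x hx hx0
  filter_upwards [hx] with y hy
  exact S.m1_eq_m2_of_balanced hx0 hy

/-- The rejection probability is bounded by the spectral bounds of `M₁` and `M₂`. -/
lemma ae_r1_le {b : ℝ} (hb : 0 ≤ b)
    (h1 : ∀ f ∈ L2zero T, (inner ℂ f (S.M1.op f)).re ≤ b * ‖f‖ ^ 2)
    (h2 : ∀ f ∈ L2zero T, -(b * ‖f‖ ^ 2) ≤ (inner ℂ f (S.M2.op f)).re) :
    ∀ᵐ x ∂T.law, S.r1 x ≤ b := by
  have key : ∀ b' > b, T.law {x | b' < S.r1 x} = 0 := by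
    intro b' hb'
    by_contra hA0
    have hA : MeasurableSet {x | b' < S.r1 x} := measurableSet_lt measurable_const S.measurable_r1
    have test1 : ∀ (B : Set E) (hB : MeasurableSet B),
        ∫ x in B, (∫ y in B, (S.M1.k x y : ℝ) ∂μ + S.M1.r x) ∂T.law - T.law.real B ^ 2
          ≤ b * (T.law.real B - T.law.real B ^ 2) := by
      intro B hB
      have he := RevKernel.inner_oneL2_indicator (T := T) hB
      have h := h1 _ (RevKernel.centered_mem_L2zero he)
      rw [S.M1.inner_op_centered he, RevKernel.norm_sq_centered he, RevKernel.norm_sq_indicator,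
        Complex.sub_re, S.M1.re_inner_op_indicator] at h
      simpa [← Complex.ofReal_pow] using h
    have test2 : ∀ (B : Set E) (hB : MeasurableSet B),
        -(b * (T.law.real B - T.law.real B ^ 2)) ≤
        ∫ x in B, (∫ y in B, (S.M2.k x y : ℝ) ∂μ + S.M2.r x) ∂T.law - T.law.real B ^ 2 := by
      intro B hB
      have he := RevKernel.inner_oneL2_indicator (T := T) hB
      have h := h2 _ (RevKernel.centered_mem_L2zero he)
      rw [S.M2.inner_op_centered he, RevKernel.norm_sq_centered he, RevKernel.norm_sq_indicator,
        Complex.sub_re, S.M2.re_inner_op_indicator] at h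
      simpa [← Complex.ofReal_pow] using h
    have hconst : ∀ (B : Set E) (c : ℝ), ∫ _x in B, c ∂T.law = T.law.real B * c := by
      intro B c; simp
    have hpos : ∀ B : Set E, T.law B ≠ 0 → 0 < T.law.real B := fun B h0 =>
      ENNReal.toReal_pos h0 (measure_ne_top _ _)
    -- On B ⊆ {r₁ > b'} the diagonal part alone gives b'π(B) - π(B)² ≤ b(π(B) - π(B)²), so π(B) ≥ b'
    -- - b: positive measure is bounded away from 0.
    obtain ⟨B, hBA, hB, hB0, hat⟩ := exists_atom_of_le_measure hA hA0 (sub_pos.2 hb') (by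
      intro B hBA hB hB0
      have h3 : ∫ _x in B, b' ∂T.law
          ≤ ∫ x in B, (∫ y in B, (S.M1.k x y : ℝ) ∂μ + S.M1.r x) ∂T.law := by
        refine setIntegral_mono_on (integrable_const _) (S.M1.integrable_indicator_form hB) hB ?_
        intro x hx
        have h4 : 0 ≤ ∫ y in B, (S.M1.k x y : ℝ) ∂μ := integral_nonneg fun y => NNReal.coe_nonneg _
        have h5 : b' < S.M1.r x := hBA hx
        linarith
      rw [hconst] at h3
      have h4 := test1 B hB
      have h5 := hpos B hB0
      have h6 : T.law.real B * (b' - T.law.real B) ≤ T.law.real B * b := by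
        nlinarith [mul_nonneg hb (sq_nonneg (T.law.real B))]
      linarith [le_of_mul_le_mul_left h6 h5])
    -- On the atom the off-diagonal parts of M₁ and M₂ cancel and the diagonals differ by 2r₁ > 2b',
    -- whereas the two tests allow a difference of at most 2b(π(B) - π(B)²).
    have h3 : ∫ _x in B, 2 * b' ∂T.law
        ≤ ∫ x in B, ((∫ y in B, (S.M1.k x y : ℝ) ∂μ + S.M1.r x)
          - (∫ y in B, (S.M2.k x y : ℝ) ∂μ + S.M2.r x)) ∂T.law := by
      refine setIntegral_mono_ae_restrict (integrable_const _)
        ((S.M1.integrable_indicator_form hB).sub (S.M2.integrable_indicator_form hB)) ?_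
      filter_upwards [S.ae_m1_eq_m2_of_atom hat, ae_restrict_mem hB] with x hx hxB
      have h4 : ∫ y in B, (S.M1.k x y : ℝ) ∂μ = ∫ y in B, (S.M2.k x y : ℝ) ∂μ := by
        refine integral_congr_ae ?_
        filter_upwards [(T.ac_law.restrict B).ae_le hx] with y hy
        exact congrArg _ hy
      have h5 : b' < S.M1.r x := hBA hxB
      have h6 : S.M2.r x = - S.M1.r x := rfl
      rw [h4, h6]; linarith
    rw [hconst, integral_sub (S.M1.integrable_indicator_form hB)
      (S.M2.integrable_indicator_form hB)] at h3
    have h4 := test1 B hB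
    have h5 := test2 B hB
    have h6 := hpos B hB0
    nlinarith [mul_nonneg hb (sq_nonneg (T.law.real B)), mul_pos h6 (sub_pos.2 hb')]
  have : ∀ᵐ x ∂T.law, ∀ n : ℕ, S.r1 x ≤ b + 1 / ((n : ℝ) + 1) := by
    rw [ae_all_iff]
    intro n
    have := key (b + 1 / ((n : ℝ) + 1)) (by simp only [gt_iff_lt, lt_add_iff_pos_right]; positivity)
    filter_upwards [measure_eq_zero_iff_ae_notMem.1 this] with x hx
    exact not_lt.1 hx
  filter_upwards [this] with x hx
  refine ge_of_tendsto' (x := atTop) ?_ hx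
  simpa using (tendsto_one_div_add_atTop_nhds_zero_nat (𝕜 := ℝ)).const_add b

end StationaryKernel

/-- For q ≥ 0 this is the triangle inequality. For q ≤ 0 compare |q + z|² ≤ q² + 2q Re z + r² with
r² if -q ≤ 2 Re z, and with (-q - 2 Re z + r)² otherwise; in the latter case the two differ by 2(-q
- 2 Re z)(r - Re z) ≥ 0. -/
lemma norm_add_le_of_bounds {q r c : ℝ} {z : ℂ} (hz : ‖z‖ ≤ r) (hr : r ≤ c)
    (h1 : q + r ≤ c) (h2 : -c ≤ q + 2 * z.re - r) : ‖(q : ℂ) + z‖ ≤ c := by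
  have hr0 : 0 ≤ r := (norm_nonneg z).trans hz
  have hre := (abs_le.1 ((Complex.abs_re_le_norm z).trans hz))
  rcases le_total 0 q with hq | hq
  · calc ‖(q : ℂ) + z‖ ≤ ‖(q : ℂ)‖ + ‖z‖ := norm_add_le _ _
      _ ≤ c := by rw [Complex.norm_real, Real.norm_of_nonneg hq]; linarith
  refine abs_le_of_sq_le_sq' ?_ (hr0.trans hr) |>.2
  have e : ‖(q : ℂ) + z‖ ^ 2 = q ^ 2 + 2 * q * z.re + ‖z‖ ^ 2 := by
    rw [Complex.sq_norm, Complex.sq_norm, Complex.normSq_apply, Complex.normSq_apply]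
    simp; ring
  have hz2 : ‖z‖ ^ 2 ≤ r ^ 2 := by gcongr
  rw [e]
  rcases le_total (-q) (2 * z.re) with h | h
  · have : r ^ 2 ≤ c ^ 2 := by gcongr
    nlinarith [mul_nonneg (neg_nonneg.2 hq) (by linarith : 0 ≤ 2 * z.re + q)]
  · have h3 : (-q - 2 * z.re + r) ^ 2 ≤ c ^ 2 := by
      have : 0 ≤ -q - 2 * z.re + r := by linarith
      gcongr; linarith
    nlinarith [mul_nonneg (by linarith : 0 ≤ -q - 2 * z.re) (by linarith : 0 ≤ r - z.re)]

/-! ### The numerical radius of P from M₁ and M₂ -/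

namespace StationaryKernel

variable {E : Type*} [MeasurableSpace E] {μ : Measure E} {T : Target μ} (S : StationaryKernel T)

lemma measurable_dens_mul_p : Measurable (fun z : E × E => T.dens z.1 * S.p z.1 z.2) :=
  (T.measurable_dens.comp measurable_fst).mul S.measurable_p

lemma measurable_form {f g : E → ℂ} (hf : Measurable f) (hg : Measurable g) :
    Measurable fun z : E × E => conj (g z.1) * f z.2 :=
  (Complex.continuous_conj.measurable.comp (hg.comp measurable_fst)).mul (hf.comp measurable_snd)

/-- Domination by the form of M₂, because p ≤ m₂. -/
lemma integrable_form (f g : Lp ℂ 2 T.law) :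
    Integrable (fun z : E × E => (T.dens z.1 * S.p z.1 z.2) • (conj (g z.1) * f z.2))
      (μ.prod μ) := by
  have h := S.M2.integrable_form (RevKernel.measurable_coe f) (RevKernel.measurable_coe g)
    (Lp.memLp f) (Lp.memLp g)
  refine h.mono (S.measurable_dens_mul_p.smul (measurable_form (RevKernel.measurable_coe f)
    (RevKernel.measurable_coe g))).aestronglyMeasurable (ae_of_all _ fun z => ?_)
  simp only [NNReal.smul_def, norm_smul, Real.norm_of_nonneg (NNReal.coe_nonneg _)]
  gcongr
  exact le_max_right _ _

/-- The sesquilinear form of the operator of a stationary kernel. -/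
lemma inner_op (f g : Lp ℂ 2 T.law) :
    inner ℂ g (S.op f)
      = ∫ z : E × E, (T.dens z.1 * S.p z.1 z.2) • (conj (g z.1) * f z.2) ∂(μ.prod μ) := by
  have := T.sFinite
  have h1 : (fun x => inner ℂ (g x) (S.op f x)) =ᵐ[T.law]
      fun x => conj (g x) * (∫ y, S.p x y • f y ∂μ) := by
    filter_upwards [coeFn_markovOp S.invariant f] with x hx
    have hx' : S.op f x = ∫ y, S.p x y • f y ∂μ := by
      refine hx.trans ?_
      rw [S.kernel_eq x]
      exact integral_withDensity_eq_integral_smul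
        (S.measurable_p.comp measurable_prodMk_left) _
    rw [hx', RCLike.inner_apply, mul_comm]
  rw [L2.inner_def, integral_congr_ae h1, integral_prod _ (S.integrable_form f g)]
  refine (integral_withDensity_eq_integral_smul T.measurable_dens _).trans ?_
  refine integral_congr_ae (ae_of_all _ fun x => ?_)
  simp only
  rw [← integral_const_mul]
  refine (integral_const_mul ((T.dens x : ℝ) : ℂ) _).symm.trans ?_
  refine integral_congr_ae (ae_of_all _ fun y => ?_)
  simp only [NNReal.smul_def, Complex.real_smul, NNReal.coe_mul, Complex.ofReal_mul]
  ring

/-- The part of the probability flow `π(x) p(x, y)` that is rejected. -/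
noncomputable def excess (x y : E) : ℝ≥0 := T.dens x * S.p x y - T.dens x * S.m1 x y

lemma excess_add (x y : E) : S.excess x y + T.dens x * S.m1 x y = T.dens x * S.p x y :=
  tsub_add_cancel_of_le (mul_le_mul_right (S.m1_le x y) _)

lemma measurable_excess : Measurable (Function.uncurry S.excess) :=
  S.measurable_dens_mul_p.sub S.M1.measurable_dens_mul_k

lemma dens_mul_m1_symm (x y : E) : T.dens x * S.m1 x y = T.dens y * S.m1 y x := by
  rw [S.dens_mul_m1, S.dens_mul_m1, min_comm]

/-- Since min + max is the sum of the two flows, the maximum is the common part plus the excess in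
both directions. -/
lemma dens_mul_m2_eq {x : E} (hx : T.dens x ≠ 0) (y : E) :
    T.dens x * S.m2 x y = T.dens x * S.m1 x y + S.excess x y + S.excess y x := by
  have h1 := S.excess_add x y
  have h2 := S.excess_add y x
  rw [S.dens_mul_m1_symm y x] at h2
  have h3 : T.dens x * S.m1 x y + T.dens x * S.m2 x y
      = T.dens x * S.p x y + T.dens y * S.p y x := by
    rw [S.dens_mul_m1, S.dens_mul_m2 hx, min_add_max, add_comm]
  rw [← h1, ← h2] at h3
  have h4 : T.dens x * S.m1 x y + T.dens x * S.m2 x y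
      = T.dens x * S.m1 x y + (T.dens x * S.m1 x y + S.excess x y + S.excess y x) := by
    rw [h3]; ring
  exact add_left_cancel h4

lemma lintegral_m1_eq (x : E) : ∫⁻ y, S.m1 x y ∂μ = 1 - ENNReal.ofReal (S.r1 x) := by
  have h : ∫⁻ y, S.m1 x y ∂μ ≠ ∞ := ((S.lintegral_m1_le x).trans_lt ENNReal.one_lt_top).ne
  rw [r1, ENNReal.ofReal_sub _ ENNReal.toReal_nonneg, ENNReal.ofReal_toReal h, ENNReal.ofReal_one,
    ENNReal.sub_sub_cancel ENNReal.one_ne_top (S.lintegral_m1_le x)]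

lemma lintegral_dens_mul_m1_ne_top (x : E) : ∫⁻ y, (T.dens x : ℝ≥0∞) * S.m1 x y ∂μ ≠ ∞ := by
  have hm : Measurable fun y => (S.m1 x y : ℝ≥0∞) :=
    (S.measurable_m1.comp measurable_prodMk_left).coe_nnreal_ennreal
  rw [lintegral_const_mul _ hm]
  exact ENNReal.mul_ne_top ENNReal.coe_ne_top
    ((S.lintegral_m1_le x).trans_lt ENNReal.one_lt_top).ne

lemma dens_eq_rejected_add (x : E) :
    (T.dens x : ℝ≥0∞) = T.dens x * ENNReal.ofReal (S.r1 x) + ∫⁻ y, (T.dens x : ℝ≥0∞) * S.m1 x y ∂μ := by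
  have hm : Measurable fun y => (S.m1 x y : ℝ≥0∞) :=
    (S.measurable_m1.comp measurable_prodMk_left).coe_nnreal_ennreal
  have h1 : ENNReal.ofReal (S.r1 x) ≤ 1 :=
    ENNReal.ofReal_le_one.2 ((le_abs_self _).trans (S.abs_r1_le x))
  rw [lintegral_const_mul _ hm, lintegral_m1_eq, ← mul_add, add_tsub_cancel_of_le h1, mul_one]

lemma lintegral_excess_right (x : E) :
    ∫⁻ y, S.excess x y ∂μ = T.dens x * ENNReal.ofReal (S.r1 x) := by
  have hm : Measurable fun y => (S.excess x y : ℝ≥0∞) :=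
    (S.measurable_excess.comp measurable_prodMk_left).coe_nnreal_ennreal
  have hp : Measurable fun y => (S.p x y : ℝ≥0∞) := S.measurable_p_coe.comp measurable_prodMk_left
  have h1 : ∫⁻ y, S.excess x y ∂μ + ∫⁻ y, (T.dens x : ℝ≥0∞) * S.m1 x y ∂μ = T.dens x := by
    rw [← lintegral_add_left hm]
    calc _ = ∫⁻ y, (T.dens x : ℝ≥0∞) * S.p x y ∂μ :=
          lintegral_congr fun y => by exact_mod_cast S.excess_add x y
      _ = T.dens x := by rw [lintegral_const_mul _ hp, S.lintegral_p, mul_one]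
  have h2 := S.dens_eq_rejected_add x
  exact (ENNReal.add_left_inj (S.lintegral_dens_mul_m1_ne_top x)).1 (h1.trans h2)

/-- Stationarity makes the total inflow at y equal to π(y); removing the symmetric part leaves the
same rejected mass as on the outgoing side. Hence the almost everywhere statement, in contrast to
`lintegral_excess_right`. -/
lemma lintegral_excess_left :
    ∀ᵐ y ∂μ, ∫⁻ x, S.excess x y ∂μ = T.dens y * ENNReal.ofReal (S.r1 y) := by
  filter_upwards [S.lintegral_dens_mul_p] with y hy
  have hm : Measurable fun x => (S.excess x y : ℝ≥0∞) :=
    (S.measurable_excess.comp measurable_prodMk_right).coe_nnreal_ennreal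
  have h1 : ∫⁻ x, S.excess x y ∂μ + ∫⁻ x, (T.dens y : ℝ≥0∞) * S.m1 y x ∂μ = T.dens y := by
    refine (lintegral_add_left hm _).symm.trans (Eq.trans (lintegral_congr fun x => ?_) hy)
    rw [← ENNReal.coe_mul, ← S.dens_mul_m1_symm x y]
    exact_mod_cast S.excess_add x y
  exact (ENNReal.add_left_inj (S.lintegral_dens_mul_m1_ne_top y)).1
    (h1.trans (S.dens_eq_rejected_add y))

/-- By the arithmetic-geometric mean inequality the left side is at most half the sum of |f|²
integrated against the two marginals of the excess, and both marginals are r₁π. -/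
lemma lintegral_excess_form_le {f : E → ℂ} (hf : Measurable f) :
    ∫⁻ z : E × E, S.excess z.1 z.2 * ‖conj (f z.1) * f z.2‖ₑ ∂(μ.prod μ)
      ≤ ∫⁻ x, ENNReal.ofReal (S.r1 x) * ‖f x‖ₑ ^ 2 ∂T.law := by
  have := T.sFinite
  have he : Measurable fun z : E × E => (S.excess z.1 z.2 : ℝ≥0∞) :=
    S.measurable_excess.coe_nnreal_ennreal
  have hF := hf.enorm.pow_const 2
  have hr : Measurable fun x => ENNReal.ofReal (S.r1 x) * ‖f x‖ₑ ^ 2 :=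
    S.measurable_r1.ennreal_ofReal.mul hF
  have hA : ∫⁻ z : E × E, S.excess z.1 z.2 * ‖f z.1‖ₑ ^ 2 ∂(μ.prod μ)
      = ∫⁻ x, ENNReal.ofReal (S.r1 x) * ‖f x‖ₑ ^ 2 ∂T.law := by
    have hm : Measurable fun z : E × E => S.excess z.1 z.2 * ‖f z.1‖ₑ ^ 2 :=
      he.mul (hF.comp measurable_fst)
    rw [lintegral_prod _ hm.aemeasurable, T.lintegral_law hr]
    refine lintegral_congr fun x => ?_
    refine (lintegral_mul_const (‖f x‖ₑ ^ 2) (he.comp measurable_prodMk_left)).trans ?_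
    refine (congrArg (· * ‖f x‖ₑ ^ 2) (S.lintegral_excess_right x)).trans ?_
    ring
  have hB : ∫⁻ z : E × E, S.excess z.1 z.2 * ‖f z.2‖ₑ ^ 2 ∂(μ.prod μ)
      = ∫⁻ x, ENNReal.ofReal (S.r1 x) * ‖f x‖ₑ ^ 2 ∂T.law := by
    have hm : Measurable fun z : E × E => S.excess z.1 z.2 * ‖f z.2‖ₑ ^ 2 :=
      he.mul (hF.comp measurable_snd)
    rw [lintegral_prod_symm _ hm.aemeasurable, T.lintegral_law hr]
    refine lintegral_congr_ae ?_
    filter_upwards [S.lintegral_excess_left] with y hy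
    refine (lintegral_mul_const (‖f y‖ₑ ^ 2) (he.comp measurable_prodMk_right)).trans ?_
    refine (congrArg (· * ‖f y‖ₑ ^ 2) hy).trans ?_
    ring
  have h2 : 2 * ∫⁻ z : E × E, S.excess z.1 z.2 * ‖conj (f z.1) * f z.2‖ₑ ∂(μ.prod μ)
      ≤ 2 * ∫⁻ x, ENNReal.ofReal (S.r1 x) * ‖f x‖ₑ ^ 2 ∂T.law := by
    calc _ = ∫⁻ z : E × E, 2 * (S.excess z.1 z.2 * ‖conj (f z.1) * f z.2‖ₑ) ∂(μ.prod μ) :=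
          (lintegral_const_mul _ (he.mul (measurable_form hf hf).enorm)).symm
      _ ≤ ∫⁻ z : E × E, (S.excess z.1 z.2 * ‖f z.1‖ₑ ^ 2 + S.excess z.1 z.2 * ‖f z.2‖ₑ ^ 2)
            ∂(μ.prod μ) := by
          refine lintegral_mono fun z => ?_
          have e2 : ‖conj (f z.1)‖ₑ = ‖f z.1‖ₑ := by
            rw [← ofReal_norm, RCLike.norm_conj, ofReal_norm]
          have h3 : 2 * (‖f z.1‖ₑ * ‖f z.2‖ₑ) ≤ ‖f z.1‖ₑ ^ 2 + ‖f z.2‖ₑ ^ 2 := by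
            have := two_mul_le_add_sq ‖f z.1‖₊ ‖f z.2‖₊
            rw [mul_assoc] at this
            simp only [enorm_eq_nnnorm]
            exact_mod_cast this
          rw [enorm_mul, e2, mul_left_comm, ← mul_add]
          gcongr
      _ = _ := by
          refine (lintegral_add_left (he.mul (hF.comp measurable_fst)) _).trans ?_
          rw [two_mul]
          exact congrArg₂ (· + ·) hA hB
  exact (ENNReal.mul_le_mul_iff_right two_ne_zero ENNReal.ofNat_ne_top).1 h2

/-- The numerical radius of a stationary kernel on `L²₀(π)` is controlled by the spectra of its two
Metropolis-Hastings kernels. -/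
lemma norm_inner_op_le {b : ℝ} (hb : 0 ≤ b)
    (h1 : ∀ f ∈ L2zero T, (inner ℂ f (S.M1.op f)).re ≤ b * ‖f‖ ^ 2)
    (h2 : ∀ f ∈ L2zero T, -(b * ‖f‖ ^ 2) ≤ (inner ℂ f (S.M2.op f)).re)
    {f : Lp ℂ 2 T.law} (hf : f ∈ L2zero T) : ‖inner ℂ f (S.op f)‖ ≤ b * ‖f‖ ^ 2 := by
  have := T.sFinite
  have hfm := RevKernel.measurable_coe f
  set F : E × E → ℂ := fun z => conj (f z.1) * f z.2 with hF
  have hFswap : ∀ z, F z.swap = conj (F z) := fun z => by simp [hF, mul_comm]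
  have hi1 : Integrable (fun z : E × E => (T.dens z.1 * S.m1 z.1 z.2) • F z) (μ.prod μ) :=
    S.M1.integrable_form hfm hfm (Lp.memLp f) (Lp.memLp f)
  have hip : Integrable (fun z : E × E => (T.dens z.1 * S.p z.1 z.2) • F z) (μ.prod μ) :=
    S.integrable_form f f
  have hep : ∀ z : E × E, (T.dens z.1 * S.p z.1 z.2) • F z
      = (T.dens z.1 * S.m1 z.1 z.2) • F z + S.excess z.1 z.2 • F z := fun z => by
    rw [← S.excess_add, add_smul, add_comm]
  have hie : Integrable (fun z : E × E => S.excess z.1 z.2 • F z) (μ.prod μ) := by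
    refine (hip.sub hi1).congr (ae_of_all _ fun z => ?_)
    simp only [Pi.sub_apply, hep, add_sub_cancel_left]
  set Q : ℂ := ∫ z : E × E, (T.dens z.1 * S.m1 z.1 z.2) • F z ∂(μ.prod μ) with hQ
  set Z : ℂ := ∫ z : E × E, S.excess z.1 z.2 • F z ∂(μ.prod μ) with hZ
  set r : ℝ := ∫ x, S.r1 x * ‖f x‖ ^ 2 ∂T.law with hr
  have hswap : ∀ G : E × E → ℂ, ∫ z, G z.swap ∂(μ.prod μ) = ∫ z, G z ∂(μ.prod μ) := fun G =>
    integral_prod_swap G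
  have hQreal : conj Q = Q := by
    rw [hQ, ← integral_conj, ← hswap]
    refine integral_congr_ae (ae_of_all _ fun z => ?_)
    simp only [Prod.fst_swap, Prod.snd_swap, hFswap]
    rw [S.dens_mul_m1_symm]
    simp [NNReal.smul_def]
  have hZconj : conj Z = ∫ z : E × E, S.excess z.2 z.1 • F z ∂(μ.prod μ) := by
    rw [hZ, ← integral_conj, ← hswap]
    refine integral_congr_ae (ae_of_all _ fun z => ?_)
    simp only [Prod.fst_swap, Prod.snd_swap, hFswap]
    simp [NNReal.smul_def]
  have hie' : Integrable (fun z : E × E => S.excess z.2 z.1 • F z) (μ.prod μ) := by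
    have h := Complex.conjCLE.toContinuousLinearMap.integrable_comp hie.swap
    refine h.congr (ae_of_all _ fun z => ?_)
    simp only [Function.comp_apply, Prod.fst_swap, Prod.snd_swap, hFswap]
    simp [NNReal.smul_def]
  have hdiag : ∫ x, (S.r1 x : ℂ) * (conj (f x) * f x) ∂T.law = (r : ℂ) := by
    rw [hr]
    refine Eq.trans ?_ integral_ofReal
    refine integral_congr_ae (ae_of_all _ fun x => ?_)
    simp only
    rw [Complex.conj_mul']
    push_cast; rfl
  have hP : inner ℂ f (S.op f) = Q + Z := by
    rw [S.inner_op, hQ, hZ, ← integral_add hi1 hie]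
    exact integral_congr_ae (ae_of_all _ hep)
  have hM1 : inner ℂ f (S.M1.op f) = Q + r := by
    rw [S.M1.inner_op, ← hdiag]; rfl
  have hM2 : inner ℂ f (S.M2.op f) = Q + Z + conj Z - r := by
    rw [S.M2.inner_op, sub_eq_add_neg, ← hdiag, ← integral_neg, hZconj, hQ, hZ,
      ← integral_add hi1 hie]
    refine Eq.trans ?_ (congrArg (· + _) (integral_add (hi1.add hie) hie'))
    congr 1
    · refine integral_congr_ae ?_
      filter_upwards [RevKernel.ae_prod_ne_zero (T := T)] with z hz
      have : T.dens z.1 * S.M2.k z.1 z.2 = _ := S.dens_mul_m2_eq hz.1 z.2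
      rw [this, add_smul, add_smul]
    · refine integral_congr_ae (ae_of_all _ fun x => ?_)
      change ((-S.r1 x : ℝ) : ℂ) * _ = _
      push_cast; ring
  have hnn : Integrable (fun x => ‖f x‖ ^ 2) T.law := by
    simpa using (Lp.memLp f).integrable_norm_pow two_ne_zero
  have hnorm : ‖f‖ ^ 2 = ∫ x, ‖f x‖ ^ 2 ∂T.law := by
    have h := L2.inner_def (𝕜 := ℂ) f f
    have e : ∫ x, inner ℂ (f x) (f x) ∂T.law = ((∫ x, ‖f x‖ ^ 2 ∂T.law : ℝ) : ℂ) := by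
      refine Eq.trans ?_ integral_ofReal
      refine integral_congr_ae (ae_of_all _ fun x => ?_)
      simp only [inner_self_eq_norm_sq_to_K]
      push_cast; rfl
    rw [e, inner_self_eq_norm_sq_to_K] at h
    apply Complex.ofReal_injective
    rw [← h]
    push_cast; rfl
  have hir : Integrable (fun x => S.r1 x * ‖f x‖ ^ 2) T.law := by
    refine hnn.mono (S.measurable_r1.mul (hfm.norm.pow_const 2)).aestronglyMeasurable
      (ae_of_all _ fun x => ?_)
    rw [norm_mul, Real.norm_eq_abs]
    exact mul_le_of_le_one_left (norm_nonneg _) (S.abs_r1_le x)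
  have hrb : r ≤ b * ‖f‖ ^ 2 := by
    rw [hr, hnorm, ← integral_const_mul]
    refine integral_mono_ae hir (hnn.const_mul b) ?_
    filter_upwards [S.ae_r1_le hb h1 h2] with x hx
    exact mul_le_mul_of_nonneg_right hx (by positivity)
  have hZr : ‖Z‖ ≤ r := by
    have hr0 : 0 ≤ r := integral_nonneg fun x => mul_nonneg (S.r1_nonneg x) (by positivity)
    have h3 : ‖Z‖ₑ ≤ ENNReal.ofReal r := by
      rw [hr, ofReal_integral_eq_lintegral_ofReal hir
        (ae_of_all _ fun x => mul_nonneg (S.r1_nonneg x) (by positivity))]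
      refine (enorm_integral_le_lintegral_enorm _).trans (le_of_eq_of_le ?_
        ((S.lintegral_excess_form_le hfm).trans (le_of_eq ?_)))
      · refine lintegral_congr fun z => ?_
        have : S.excess z.1 z.2 • F z = ((S.excess z.1 z.2 : ℝ) : ℂ) * F z := rfl
        rw [this, enorm_mul]
        congr 1
        rw [← ofReal_norm, Complex.norm_real, Real.norm_of_nonneg (NNReal.coe_nonneg _),
          ENNReal.ofReal_coe_nnreal]
      · refine lintegral_congr fun x => ?_
        rw [ENNReal.ofReal_mul (S.r1_nonneg x), ENNReal.ofReal_pow (norm_nonneg _), ofReal_norm]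
    rw [← ofReal_norm] at h3
    exact (ENNReal.ofReal_le_ofReal_iff hr0).1 h3
  have hQre : Q = (Q.re : ℂ) := (Complex.conj_eq_iff_re.1 hQreal).symm
  have h3 := h1 f hf
  have h4 := h2 f hf
  rw [hM1, Complex.add_re, Complex.ofReal_re] at h3
  rw [hM2] at h4
  simp only [Complex.sub_re, Complex.add_re, Complex.conj_re, Complex.ofReal_re] at h4
  rw [hP, hQre]
  exact norm_add_le_of_bounds hZr hrb h3 (by linarith)

end StationaryKernel

/-! ### The Markov property in L² -/

section Chain

variable {E : Type*} [MeasurableSpace E] {Ω : Type*} [MeasurableSpace Ω] {Pr : Measure Ω}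
  {X : ℕ → Ω → E} {κ : Kernel E E} {ν : Measure E}

lemma IsMarkovChain.measurePreserving (hX : IsMarkovChain Pr X κ ν) (hκ : κ.Invariant ν) (n : ℕ) :
    MeasurePreserving (X n) Pr ν := by
  refine ⟨hX.measurable n, ?_⟩
  induction n with
  | zero => exact hX.initial
  | succ n ih =>
    ext A hA
    have h := hX.markov n A hA Set.univ MeasurableSet.univ
    have hb : ν.bind κ A = ν A := by rw [hκ.def]
    rw [Set.univ_inter, Measure.restrict_univ] at h
    rw [Measure.map_apply (hX.measurable _) hA, h, ← hb, Measure.bind_apply hA κ.aemeasurable, ← ih,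
      lintegral_map (κ.measurable_coe hA) (hX.measurable n)]

variable [IsProbabilityMeasure Pr] [IsProbabilityMeasure ν] [IsMarkovKernel κ]

/-- The Markov property for square integrable functions. -/
lemma IsMarkovChain.setIntegral_succ (hX : IsMarkovChain Pr X κ ν) (hκ : κ.Invariant ν)
    {i j : ℕ} (hij : i ≤ j) {G : Set E} (hG : MeasurableSet G) (f : Lp ℂ 2 ν) :
    ∫ ω in X i ⁻¹' G, pullback (hX.measurePreserving hκ (j + 1)) f ω ∂Pr
      = ∫ ω in X i ⁻¹' G, pullback (hX.measurePreserving hκ j) (markovOp hκ f) ω ∂Pr := by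
  set ρ := Pr.restrict (X i ⁻¹' G) with hρ
  have hm : (ρ.map (X (j + 1))) = κ ∘ₘ (ρ.map (X j)) := by
    ext A hA
    rw [Measure.map_apply (hX.measurable _) hA, Measure.bind_apply hA κ.aemeasurable,
      lintegral_map (κ.measurable_coe hA) (hX.measurable j), hρ,
      Measure.restrict_apply (hX.measurable _ hA), Set.inter_comm]
    -- The event {X i ∈ G} belongs to the past of time j because i ≤ j.
    refine hX.markov j A hA _ ?_
    have hle := le_iSup (fun l : Fin (j + 1) => MeasurableSpace.comap (X l) inferInstance)
      ⟨i, by omega⟩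
    exact hle _ ⟨G, hG, rfl⟩
  have hρle : ρ.map (X (j + 1)) ≤ ν := by
    rw [← (hX.measurePreserving hκ (j + 1)).map_eq]
    exact Measure.map_mono Measure.restrict_le_self (hX.measurable _)
  have hf : Integrable f (κ ∘ₘ (ρ.map (X j))) := by
    rw [← hm]; exact (integrable_coe_L2 f).mono_measure hρle
  have hlhs : ∫ ω, pullback (hX.measurePreserving hκ (j + 1)) f ω ∂ρ
      = ∫ y, f y ∂(ρ.map (X (j + 1))) := by
    rw [integral_congr_ae (ae_restrict_of_ae (coeFn_pullback _ f)),
      integral_map_of_stronglyMeasurable (hX.measurable _) (Lp.stronglyMeasurable f)]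
    rfl
  have hrhs : ∫ ω, pullback (hX.measurePreserving hκ j) (markovOp hκ f) ω ∂ρ
      = ∫ x, markovOp hκ f x ∂(ρ.map (X j)) := by
    rw [integral_congr_ae (ae_restrict_of_ae (coeFn_pullback _ _)),
      integral_map_of_stronglyMeasurable (hX.measurable _) (Lp.stronglyMeasurable _)]
    rfl
  have hac : ρ.map (X j) ≪ ν := by
    rw [← (hX.measurePreserving hκ j).map_eq]
    exact (Measure.absolutelyContinuous_of_le Measure.restrict_le_self).map (hX.measurable j)
  rw [hlhs, hrhs, hm, integral_comp_measure hf]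
  exact (integral_congr_ae (hac.ae_le (coeFn_markovOp hκ f))).symm

/-- The difference of the two right-hand vectors is orthogonal to all functions of X i: its image
under the adjoint of that pullback is orthogonal to indicators, hence 0. -/
lemma IsMarkovChain.inner_succ (hX : IsMarkovChain Pr X κ ν) (hκ : κ.Invariant ν)
    {i j : ℕ} (hij : i ≤ j) (f g : Lp ℂ 2 ν) :
    inner ℂ (pullback (hX.measurePreserving hκ i) g) (pullback (hX.measurePreserving hκ (j + 1)) f)
      = inner ℂ (pullback (hX.measurePreserving hκ i) g)
        (pullback (hX.measurePreserving hκ j) (markovOp hκ f)) := by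
  set w := pullback (hX.measurePreserving hκ (j + 1)) f
    - pullback (hX.measurePreserving hκ j) (markovOp hκ f) with hw
  set A := (pullback (hX.measurePreserving hκ i)).toContinuousLinearMap with hA
  have h0 : ContinuousLinearMap.adjoint A w = 0 := by
    refine L2_eq_zero_of_inner_indicator fun G hG => ?_
    rw [ContinuousLinearMap.adjoint_inner_right, hw, inner_sub_right, sub_eq_zero]
    refine (inner_pullback_indicator _ hG _).trans
      (Eq.trans ?_ (inner_pullback_indicator _ hG _).symm)
    exact hX.setIntegral_succ hκ hij hG f
  have h1 := ContinuousLinearMap.adjoint_inner_right A g w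
  rw [h0, inner_zero_right, hw, inner_sub_right] at h1
  exact (sub_eq_zero.1 h1.symm)

end Chain

/-! ### Variances as squared norms -/

section Variance

variable {E : Type*} [MeasurableSpace E] {μ : Measure E} {T : Target μ}
  {Ω : Type*} [MeasurableSpace Ω] {Pr : Measure Ω}

lemma cVar_eq_norm_sq {Z : Ω → ℂ} {w : Lp ℂ 2 Pr} (h : w =ᵐ[Pr] fun ω => Z ω - ∫ ω', Z ω' ∂Pr) :
    cVar Pr Z = ‖w‖ ^ 2 := by
  have h1 := L2.inner_def (𝕜 := ℂ) w w
  have e : ∫ ω, inner ℂ (w ω) (w ω) ∂Pr = ((cVar Pr Z : ℝ) : ℂ) := by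
    refine Eq.trans ?_ integral_ofReal
    refine integral_congr_ae ?_
    filter_upwards [h] with ω hω
    rw [← hω, inner_self_eq_norm_sq_to_K]
    push_cast; rfl
  rw [e, inner_self_eq_norm_sq_to_K] at h1
  apply Complex.ofReal_injective
  rw [← h1]
  push_cast; rfl

open Classical in
/-- The element `f - π(f)` of `L²₀(π)`. -/
noncomputable def centered (T : Target μ) (f : E → ℂ) : L2zero T :=
  if h : MemLp f 2 T.law then
    ⟨h.toLp f - (∫ x, f x ∂T.law) • oneL2 T, by
      rw [mem_L2zero_iff, inner_sub_right, inner_smul_right, inner_self_eq_norm_sq_to_K,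
        RevKernel.norm_oneL2, inner_oneL2, integral_congr_ae h.coeFn_toLp]
      simp⟩
  -- The default makes this total, so a sequence f may fail square integrability at indices outside
  -- the sum.
  else 0

lemma coeFn_centered {f : E → ℂ} (h : MemLp f 2 T.law) :
    (centered T f : Lp ℂ 2 T.law) =ᵐ[T.law] fun x => f x - ∫ y, f y ∂T.law := by
  have h1 : (oneL2 T : E → ℂ) =ᵐ[T.law] fun _ => 1 :=
    indicatorConstLp_coeFn.trans (ae_of_all _ fun x => by simp)
  rw [centered, dif_pos h]
  filter_upwards [Lp.coeFn_sub (h.toLp f) ((∫ x, f x ∂T.law) • oneL2 T), h.coeFn_toLp,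
    Lp.coeFn_smul (∫ x, f x ∂T.law) (oneL2 T), h1] with x h2 h3 h4 h5
  rw [h2, Pi.sub_apply, h3, h4, Pi.smul_apply, h5, smul_eq_mul, mul_one]

lemma cVar_law_eq {f : E → ℂ} (h : MemLp f 2 T.law) : cVar T.law f = ‖centered T f‖ ^ 2 :=
  cVar_eq_norm_sq (coeFn_centered h)

end Variance

/-! ### The chain as a family of isometries of L²₀(π) -/

section ChainZero

variable {E : Type*} [MeasurableSpace E] {μ : Measure E} {T : Target μ} {S : StationaryKernel T}
  {Ω : Type*} [MeasurableSpace Ω] {Pr : Measure Ω} {X : ℕ → Ω → E}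

/-- The isometry `f ↦ f(Xₙ)` on `L²₀(π)`. -/
noncomputable def IsMarkovChain.eval (hX : IsMarkovChain Pr X S.kernel T.law) (n : ℕ) :
    L2zero T →ₗᵢ[ℂ] Lp ℂ 2 Pr :=
  (pullback (hX.measurePreserving S.invariant n)).comp (L2zero T).subtypeₗᵢ

lemma IsMarkovChain.coeFn_eval_centered (hX : IsMarkovChain Pr X S.kernel T.law) (n : ℕ) {f : E → ℂ}
    (hf : MemLp f 2 T.law) :
    hX.eval n (centered T f) =ᵐ[Pr] fun ω => f (X n ω) - ∫ y, f y ∂T.law :=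
  (coeFn_pullback _ _).trans
    ((hX.measurePreserving S.invariant n).quasiMeasurePreserving.ae_eq_comp (coeFn_centered hf))

lemma IsMarkovChain.cVar_sum (hX : IsMarkovChain Pr X S.kernel T.law) (s : Finset ℕ)
    {f : ℕ → E → ℂ} (hf : ∀ i ∈ s, MemLp (f i) 2 T.law) :
    cVar Pr (fun ω => ∑ i ∈ s, f i (X i ω)) = ‖∑ i ∈ s, hX.eval i (centered T (f i))‖ ^ 2 := by
  have hmp := fun i => hX.measurePreserving S.invariant i
  have hint : ∫ ω, ∑ i ∈ s, f i (X i ω) ∂Pr = ∑ i ∈ s, ∫ y, f i y ∂T.law := by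
    have hI : ∀ i ∈ s, Integrable (fun ω => f i (X i ω)) Pr := fun i hi =>
      (hmp i).integrable_comp_of_integrable ((hf i hi).integrable one_le_two)
    rw [integral_finsetSum _ hI]
    refine Finset.sum_congr rfl fun i hi => ?_
    have h := integral_map (μ := Pr) (hX.measurable i).aemeasurable (f := f i)
      (by rw [(hmp i).map_eq]; exact (hf i hi).1)
    rw [← h, (hmp i).map_eq]
  refine cVar_eq_norm_sq ?_
  rw [hint]
  have h1 : ∀ᵐ ω ∂Pr, ∀ i ∈ s, hX.eval i (centered T (f i)) ω
      = f i (X i ω) - ∫ y, f i y ∂T.law := by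
    rw [eventually_all_finset]
    exact fun i hi => hX.coeFn_eval_centered i (hf i hi)
  have h2 := Lp.coeFn_finsetSum s fun i => hX.eval i (centered T (f i))
  filter_upwards [h1, h2] with ω h3 h4
  rw [h4, Finset.sum_apply, ← Finset.sum_sub_distrib]
  exact Finset.sum_congr rfl h3

lemma IsMarkovChain.cVar_eval (hX : IsMarkovChain Pr X S.kernel T.law) (n : ℕ) {f : E → ℂ}
    (hf : MemLp f 2 T.law) : cVar Pr (fun ω => f (X n ω)) = ‖centered T f‖ ^ 2 := by
  have := hX.cVar_sum {n} (f := fun _ => f) (by simpa using hf)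
  simpa using this

variable [IsProbabilityMeasure Pr]

lemma IsMarkovChain.inner_eval (hX : IsMarkovChain Pr X S.kernel T.law) (i j : ℕ) (hij : i ≤ j)
    (x y : L2zero T) :
    inner ℂ (hX.eval i x) (hX.eval j y) = inner ℂ x ((S.opZero ^ (j - i)) y) := by
  induction j, hij using Nat.le_induction generalizing y with
  | base => simp
  | succ j hij ih =>
    have h := hX.inner_succ S.invariant hij (y : Lp ℂ 2 T.law) (x : Lp ℂ 2 T.law)
    rw [Nat.succ_sub hij, pow_succ, mul_apply_eq_comp, ← ih]
    exact h

end ChainZero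

/-! ### Good times and β^MH -/

namespace StationaryKernel

variable {E : Type*} [MeasurableSpace E] {μ : Measure E} {T : Target μ} (S : StationaryKernel T)

lemma root_le_betaMH {n : ℕ+} (hn : n ∈ S.goodTimes) {b : ℝ} (hb : b ∈
    {b | ∃ n ∈ S.goodTimes, b = |(S.pow n).M2.specInf| ^ (1 / (n : ℝ)) ∨
      b = (max (S.pow n).M1.specSup 0) ^ (1 / (n : ℝ))}) : b ≤ S.betaMH := by
  rw [betaMH, if_neg (Set.nonempty_iff_ne_empty.1 ⟨n, hn⟩)]
  -- A real `sSup` dominates its members only for bounded sets; membership in 𝒞 bounds all the roots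
  -- by 1.
  refine le_csSup ⟨1, ?_⟩ hb
  rintro _ ⟨m, hm, rfl | rfl⟩
  · exact Real.rpow_le_one (abs_nonneg _) hm.1.le (by positivity)
  · exact Real.rpow_le_one (le_max_right _ _) (max_le hm.2.le zero_le_one) (by positivity)

lemma betaMH_nonneg : 0 ≤ S.betaMH := by
  rcases S.goodTimes.eq_empty_or_nonempty with h | ⟨n, hn⟩
  · rw [betaMH, if_pos h]; exact zero_le_one
  · exact (Real.rpow_nonneg (abs_nonneg _) _).trans (S.root_le_betaMH hn ⟨n, hn, Or.inl rfl⟩)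

lemma le_pow_of_root_le {a c : ℝ} (ha : 0 ≤ a) {n : ℕ+} (h : a ^ (1 / (n : ℝ)) ≤ c) :
    a ≤ c ^ (n : ℕ) := by
  calc a = (a ^ (1 / (n : ℝ))) ^ (n : ℕ) := by
        rw [one_div]; exact (Real.rpow_inv_natCast_pow ha n.ne_zero).symm
    _ ≤ _ := by gcongr

lemma norm_inner_opZero_pow_le {n : ℕ+} (hn : n ∈ S.goodTimes) (x : L2zero T) :
    ‖inner ℂ x ((S.opZero ^ (n : ℕ)) x)‖ ≤ S.betaMH ^ (n : ℕ) * ‖x‖ ^ 2 := by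
  have hb1 : |(S.pow n).M2.specInf| ≤ S.betaMH ^ (n : ℕ) :=
    le_pow_of_root_le (abs_nonneg _) (S.root_le_betaMH hn ⟨n, hn, Or.inl rfl⟩)
  have hb2 : max (S.pow n).M1.specSup 0 ≤ S.betaMH ^ (n : ℕ) :=
    le_pow_of_root_le (le_max_right _ _) (S.root_le_betaMH hn ⟨n, hn, Or.inr rfl⟩)
  have h := (S.pow n).norm_inner_op_le (pow_nonneg S.betaMH_nonneg n)
    (fun f hf => ((S.pow n).M1.re_inner_op_le_specSup hf).trans
      (mul_le_mul_of_nonneg_right ((le_max_left _ _).trans hb2) (by positivity)))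
    (fun f hf => le_trans (by
      rw [← neg_mul]
      exact mul_le_mul_of_nonneg_right (neg_le_of_abs_le hb1) (by positivity))
      ((S.pow n).M2.specInf_le_re_inner_op hf)) x.2
  rw [op_pow, ← coe_opZero_pow] at h
  exact h

/-- The least good time exceeds the number of bad times by at most one. -/
lemma exists_goodTime_le (hfin : S.goodTimesᶜ.Finite) :
    ∃ n ∈ S.goodTimes, (n : ℕ) ≤ S.goodTimesᶜ.ncard + 1 := by
  by_contra! hcon
  -- Otherwise 1, …, |𝒞ᶜ| + 1 would all be bad times, one more than there are.
  have hsub : Set.Icc 1 (Nat.toPNat' (S.goodTimesᶜ.ncard + 1)) ⊆ S.goodTimesᶜ := by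
    intro m hm hmC
    have h1 := hcon m hmC
    have h2 : (m : ℕ) ≤ (Nat.toPNat' (S.goodTimesᶜ.ncard + 1) : ℕ) := hm.2
    rw [Nat.toPNat'_coe, if_pos (Nat.succ_pos _)] at h2
    omega
  have h3 := Set.ncard_le_ncard hsub hfin
  rw [← Finset.coe_Icc, Set.ncard_coe_finset, PNat.card_Icc, Nat.toPNat'_coe,
    if_pos (Nat.succ_pos _), PNat.one_coe] at h3
  omega

end StationaryKernel

lemma sum_Icc_one_eq_sum_range {M : Type*} [AddCommMonoid M] (F : ℕ → M) (n : ℕ) :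
    ∑ i ∈ Finset.Icc 1 n, F i = ∑ i ∈ Finset.range n, F (i + 1) := by
  rw [Finset.range_eq_Ico, Finset.sum_Ico_add' F 0 n 1]
  rfl

/-! ### The variance bounds for the chain -/

section Bounds

variable {E : Type*} [MeasurableSpace E] {μ : Measure E} {T : Target μ} {S : StationaryKernel T}
  {Ω : Type*} [MeasurableSpace Ω] {Pr : Measure Ω} [IsProbabilityMeasure Pr] {X : ℕ → Ω → E}

lemma IsMarkovChain.inner_eval_succ (hX : IsMarkovChain Pr X S.kernel T.law) (i j : ℕ) (hij : i ≤ j)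
    (x y : L2zero T) :
    inner ℂ (hX.eval (i + 1) x) (hX.eval (j + 1) y) = inner ℂ x ((S.opZero ^ (j - i)) y) := by
  rw [hX.inner_eval _ _ (by omega), Nat.add_sub_add_right]

lemma IsMarkovChain.norm_sq_sum_eval_le (hX : IsMarkovChain Pr X S.kernel T.law)
    (hγ : 0 < S.gammaMH) (hfin : S.goodTimesᶜ.Finite) (x : ℕ → L2zero T) (n : ℕ) :
    ‖∑ i ∈ Finset.Icc 1 n, hX.eval i (x i)‖ ^ 2
      ≤ (∑ i ∈ Finset.Icc 1 n, ‖x i‖ ^ 2) * (S.goodTimesᶜ.ncard + 2 / S.gammaMH) := by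
  obtain ⟨k, hk, hkle⟩ := S.exists_goodTime_le hfin
  have hβ0 := S.betaMH_nonneg
  have hβ1 : S.betaMH < 1 := by unfold StationaryKernel.gammaMH at hγ; linarith
  rw [sum_Icc_one_eq_sum_range, sum_Icc_one_eq_sum_range (fun i => ‖x i‖ ^ 2), mul_comm]
  refine (norm_sq_sum_le_of_pow (V := fun i => hX.eval (i + 1)) hX.inner_eval_succ k.pos
    (pow_nonneg hβ0 k) (pow_lt_one₀ hβ0 hβ1 k.ne_zero) (S.norm_inner_opZero_pow_le hk)
    (fun i => x (i + 1)) n).trans ?_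
  refine mul_le_mul_of_nonneg_right ((card_mul_ratio_le hβ0 hβ1 k.pos).trans ?_)
    (Finset.sum_nonneg fun _ _ => by positivity)
  have : (k : ℝ) ≤ S.goodTimesᶜ.ncard + 1 := by exact_mod_cast hkle
  rw [StationaryKernel.gammaMH]
  have e : ((k : ℕ) : ℝ) = (k : ℝ) := rfl
  linarith

/-- Treats the infinite bracket: if all variances vanish, then 0·∞ = 0 forces the left side to
vanish too, which it does; if not, the right side is ∞. -/
lemma IsMarkovChain.ofReal_norm_sq_sum_eval_le (hX : IsMarkovChain Pr X S.kernel T.law)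
    (x : ℕ → L2zero T) (n : ℕ) :
    ENNReal.ofReal (‖∑ i ∈ Finset.Icc 1 n, hX.eval i (x i)‖ ^ 2)
      ≤ ENNReal.ofReal (∑ i ∈ Finset.Icc 1 n, ‖x i‖ ^ 2)
        * ((S.goodTimesᶜ.encard : ℝ≥0∞) + 2 / ENNReal.ofReal S.gammaMH) := by
  have hW0 : 0 ≤ ∑ i ∈ Finset.Icc 1 n, ‖x i‖ ^ 2 := Finset.sum_nonneg fun _ _ => by positivity
  rcases hW0.eq_or_lt with hW | hW
  · have h0 := (Finset.sum_eq_zero_iff_of_nonneg fun i _ => sq_nonneg ‖x i‖).1 hW.symm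
    have : ∑ i ∈ Finset.Icc 1 n, hX.eval i (x i) = 0 :=
      Finset.sum_eq_zero fun i hi => by
        rw [norm_eq_zero.1 (pow_eq_zero_iff two_ne_zero |>.1 (h0 i hi)), map_zero]
    simp [this]
  have hWne : ENNReal.ofReal (∑ i ∈ Finset.Icc 1 n, ‖x i‖ ^ 2) ≠ 0 := by simpa using hW
  rcases le_or_gt S.gammaMH 0 with hγ | hγ
  · rw [ENNReal.ofReal_of_nonpos hγ, ENNReal.div_zero two_ne_zero, add_top,
      ENNReal.mul_top hWne]
    exact le_top
  by_cases hfin : S.goodTimesᶜ.Finite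
  · refine (ENNReal.ofReal_le_ofReal (hX.norm_sq_sum_eval_le hγ hfin x n)).trans (le_of_eq ?_)
    rw [ENNReal.ofReal_mul hW0, ENNReal.ofReal_add (by positivity) (by positivity),
      ENNReal.ofReal_div_of_pos hγ, ENNReal.ofReal_natCast, ENNReal.ofReal_ofNat,
      ← hfin.cast_ncard_eq]
    simp
  · rw [Set.encard_eq_top_iff.2 hfin, ENat.toENNReal_top, top_add, ENNReal.mul_top hWne]
    exact le_top

lemma IsMarkovChain.exists_asymptotic_variance (hX : IsMarkovChain Pr X S.kernel T.law)
    (hγ : 0 < S.gammaMH) (hfin : S.goodTimesᶜ.Finite) (x : L2zero T) :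
    ∃ σ2 : ℝ, ∀ n : ℕ, |‖∑ i ∈ Finset.Icc 1 n, hX.eval i x‖ ^ 2 - n * σ2|
      ≤ 4 * ‖x‖ ^ 2 * (1 + S.goodTimesᶜ.ncard
        + 4 * S.betaMH ^ (S.goodTimesᶜ.ncard + 1) / S.gammaMH) ^ 2 := by
  have hβ0 := S.betaMH_nonneg
  have hβ1 : S.betaMH < 1 := by unfold StationaryKernel.gammaMH at hγ; linarith
  set F : Finset ℕ := hfin.toFinset.map ⟨fun n : ℕ+ => (n : ℕ), PNat.coe_injective⟩ with hF
  have hcard : F.card = S.goodTimesᶜ.ncard := by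
    rw [hF, Finset.card_map, Set.ncard_eq_toFinset_card _ hfin]
  have hF0 : 0 ∉ F := by simp [hF]
  have hFgood : ∀ j, 0 < j → j ∉ F → ∀ y : L2zero T,
      ‖inner ℂ y ((S.opZero ^ j) y)‖ ≤ S.betaMH ^ j * ‖y‖ ^ 2 := by
    intro j hj hjF y
    have : (⟨j, hj⟩ : ℕ+) ∈ S.goodTimes := by
      by_contra hc
      exact hjF (Finset.mem_map.2 ⟨⟨j, hj⟩, hfin.mem_toFinset.2 hc, rfl⟩)
    exact S.norm_inner_opZero_pow_le this y
  set R : ℝ := 1 + S.goodTimesᶜ.ncard + 4 * S.betaMH ^ (S.goodTimesᶜ.ncard + 1) / S.gammaMH with hR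
  have hsolve : ∀ y : L2zero T, ∃ g, g - S.opZero g = y ∧ ‖g‖ ≤ R * ‖y‖ := by
    intro y
    have := exists_sub_eq_of_numericalRadius S.opZero S.norm_opZero_pow_le hβ0 hβ1 F hF0 hFgood y
    rwa [hcard] at this
  have hR0 : 0 ≤ R := by positivity
  obtain ⟨g, hg, hgR⟩ := hsolve x
  obtain ⟨h, hh, hhR⟩ := hsolve g
  -- The asymptotic variance is the squared norm of the martingale increment attached to g; the
  -- remainder is at most 4‖x‖‖h‖ with ‖h‖ ≤ R²‖x‖.
  refine ⟨‖g‖ ^ 2 - ‖S.opZero g‖ ^ 2, fun n => ?_⟩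
  rw [sum_Icc_one_eq_sum_range (fun i => hX.eval i x),
    norm_sq_sum_eq_poisson (V := fun i => hX.eval (i + 1)) hX.inner_eval_succ hg hh, sub_sub_cancel_left,
    abs_neg, abs_mul, abs_two]
  have h1 : ‖S.opZero h - (S.opZero ^ (n + 1)) h‖ ≤ 2 * ‖h‖ := by
    have h2 := S.norm_opZero_pow_le 1 h
    rw [pow_one] at h2
    linarith [norm_sub_le (S.opZero h) ((S.opZero ^ (n + 1)) h), S.norm_opZero_pow_le (n + 1) h]
  have h3 : ‖h‖ ≤ R ^ 2 * ‖x‖ := by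
    calc ‖h‖ ≤ R * ‖g‖ := hhR
      _ ≤ R * (R * ‖x‖) := by gcongr
      _ = _ := by ring
  calc 2 * |(inner ℂ x (S.opZero h - (S.opZero ^ (n + 1)) h)).re|
      ≤ 2 * (‖x‖ * ‖S.opZero h - (S.opZero ^ (n + 1)) h‖) := by
        gcongr
        exact (Complex.abs_re_le_norm _).trans (norm_inner_le_norm (𝕜 := ℂ) (E := L2zero T) _ _)
    _ ≤ 2 * (‖x‖ * (2 * (R ^ 2 * ‖x‖))) := by gcongr; linarith
    _ = _ := by ring

end Bounds

lemma tendsto_div_of_abs_sub_le {u : ℕ → ℝ} {σ2 C : ℝ} (h : ∀ n : ℕ, |u n - n * σ2| ≤ C) :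
    Tendsto (fun n : ℕ => 1 / (n : ℝ) * u n) atTop (𝓝 σ2) := by
  rw [tendsto_iff_norm_sub_tendsto_zero]
  refine squeeze_zero' (Eventually.of_forall fun _ => norm_nonneg _) ?_
    (tendsto_const_div_atTop_nhds_zero_nat C)
  filter_upwards [eventually_gt_atTop 0] with n hn
  have hn' : (0 : ℝ) < n := by exact_mod_cast hn
  have e : 1 / (n : ℝ) * u n - σ2 = (u n - n * σ2) / n := by field_simp
  rw [e, norm_div, Real.norm_eq_abs, Real.norm_of_nonneg hn'.le]
  gcongr
  exact h n

end MHGap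

open MHGap in
theorem mainTheorem5 {E : Type*} [MeasurableSpace E] {μ : Measure E} {T : Target μ}
    (S : StationaryKernel T) {Ω : Type*} [MeasurableSpace Ω] (Pr : Measure Ω)
    [IsProbabilityMeasure Pr] (X : ℕ → Ω → E) (hX : IsMarkovChain Pr X S.kernel T.law) :
    (∀ f : E → ℂ, MemLp f 2 T.law → ∀ n : ℕ,
      ENNReal.ofReal (cVar Pr fun ω => ∑ i ∈ Finset.Icc 1 n, f (X i ω)) ≤
        n * ENNReal.ofReal (cVar T.law f) *
          ((S.goodTimesᶜ.encard : ℝ≥0∞) + 2 / ENNReal.ofReal S.gammaMH)) ∧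
    (∀ f : E → ℂ, MemLp f 2 T.law → S.goodTimesᶜ.Finite → 0 < S.gammaMH →
      ∃ σ2 : ℝ,
        Tendsto (fun n : ℕ =>
          1 / (n : ℝ) * cVar Pr fun ω => ∑ i ∈ Finset.Icc 1 n, f (X i ω)) atTop (𝓝 σ2) ∧
        ∀ n : ℕ,
          |(cVar Pr fun ω => ∑ i ∈ Finset.Icc 1 n, f (X i ω)) - n * σ2| ≤
            4 * cVar T.law f *
              (1 + S.goodTimesᶜ.ncard +
                4 * S.betaMH ^ (S.goodTimesᶜ.ncard + 1) / S.gammaMH) ^ 2) ∧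
    (∀ (n : ℕ) (f : ℕ → E → ℂ), (∀ i ∈ Finset.Icc 1 n, MemLp (f i) 2 T.law) →
      ENNReal.ofReal (cVar Pr fun ω => ∑ i ∈ Finset.Icc 1 n, f i (X i ω)) ≤
        (∑ i ∈ Finset.Icc 1 n, ENNReal.ofReal (cVar Pr fun ω => f i (X i ω))) *
          ((S.goodTimesᶜ.encard : ℝ≥0∞) + 2 / ENNReal.ofReal S.gammaMH)) := by

  have h3 : ∀ (n : ℕ) (f : ℕ → E → ℂ), (∀ i ∈ Finset.Icc 1 n, MemLp (f i) 2 T.law) →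
      ENNReal.ofReal (cVar Pr fun ω => ∑ i ∈ Finset.Icc 1 n, f i (X i ω)) ≤
        (∑ i ∈ Finset.Icc 1 n, ENNReal.ofReal (cVar Pr fun ω => f i (X i ω))) *
          ((S.goodTimesᶜ.encard : ℝ≥0∞) + 2 / ENNReal.ofReal S.gammaMH) := by
    intro n f hf
    have e : ∑ i ∈ Finset.Icc 1 n, ENNReal.ofReal (cVar Pr fun ω => f i (X i ω))
        = ENNReal.ofReal (∑ i ∈ Finset.Icc 1 n, ‖centered T (f i)‖ ^ 2) := by
      rw [ENNReal.ofReal_sum_of_nonneg fun i _ => by positivity]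
      exact Finset.sum_congr rfl fun i hi => by rw [hX.cVar_eval i (hf i hi)]
    rw [hX.cVar_sum _ hf, e]
    exact hX.ofReal_norm_sq_sum_eval_le _ n
  refine ⟨fun f hf n => ?_, fun f hf hfin hγ => ?_, h3⟩
  -- Part (1) is part (3) for a constant sequence, since by stationarity all f(X i) have the
  -- variance of f under π.
  · refine (h3 n (fun _ => f) fun _ _ => hf).trans (le_of_eq ?_)
    congr 1
    rw [cVar_law_eq hf, Finset.sum_congr rfl fun i _ => by rw [hX.cVar_eval i hf]]
    simp
  · obtain ⟨σ2, hσ⟩ := hX.exists_asymptotic_variance hγ hfin (centered T f)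
    have hσ' : ∀ n : ℕ, |(cVar Pr fun ω => ∑ i ∈ Finset.Icc 1 n, f (X i ω)) - n * σ2| ≤
        4 * cVar T.law f * (1 + S.goodTimesᶜ.ncard +
          4 * S.betaMH ^ (S.goodTimesᶜ.ncard + 1) / S.gammaMH) ^ 2 := by
      intro n
      rw [hX.cVar_sum _ (f := fun _ => f) fun _ _ => hf, cVar_law_eq hf]
      exact hσ n
    exact ⟨σ2, tendsto_div_of_abs_sub_le hσ', hσ'⟩
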